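/- Let $n \ge 1$. For a bounded domain (nonempty connected bounded open set) $\Omega \subset \mathbb{R}^n$, let $0 < \lambda_1(\Omega) \le \lambda_2(\Omega) \le \lambda_3(\Omega) \le \cdots$ be the eigenvalues, repeated according to multiplicity, of the Dirichlet problem $\Delta u = -\lambda u$ in $\Omega$, $u = 0$ on $\partial\Omega$, understood in the weak sense: $\lambda$ is an eigenvalue with eigenfunction $u \in H^1_0(\Omega) \setminus \{0\}$ if $\int_\Omega \nabla u \cdot \nabla \varphi = \lambda \int_\Omega u \varphi$ for all $\varphi \in C_c^\infty(\Omega)$. Let $C_0(n)$ denote the optimal constant in the Cheng–Yang inequality, that is, the infimum of all real $C$ such that $$\lambda_{k+1}(\Omega) \le C\, k^{2/n}\, \lambda_1(\Omega) \qquad \text{for all bounded domains } \Omega \subset \mathbb{R}^n \text{ and all integers } k \ge 1. \tag{1}$$ Then (1) holds with $C = C_0(n)$ (so $C_0(n)$ is the least constant for which (1) holds), $C_0(n) \le 1 + \frac{4}{n}$, and for every bounded domain $\Omega \subset \mathbb{R}^n$ and every integer $k \ge 1$, $$\lambda_{k+1}(\Omega) - \lambda_k(\Omega) \le C_{n,\Omega}\,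 k^{1/n}, \qquad C_{n,\Omega} = 4 \lambda_1(\Omega) \sqrt{\frac{C_0(n)}{n}} .$$ In particular, the gap estimate holds with $C_0(n)$ replaced by any constant $C$ satisfying (1), for instance $C = 1 + \frac{4}{n}$. -/

import Mathlib

open MeasureTheory

/-- A bounded domain of `ℝⁿ`: a nonempty, connected, open and bounded set. -/
structure IsBoundedDomain {n : ℕ} (Ω : Set (EuclideanSpace ℝ (Fin n))) : Prop where
  isOpen : IsOpen Ω
  isConnected : IsConnected Ω
  isBounded : Bornology.IsBounded Ω

/-- The real Hilbert space `L²(Ω)` of real-valued functions. -/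
abbrev L2Scalar {n : ℕ} (Ω : Set (EuclideanSpace ℝ (Fin n))) : Type :=
  Lp ℝ 2 (volume.restrict Ω)

/-- The real Hilbert space `L²(Ω; ℝⁿ)` of vector fields. -/
abbrev L2Vector {n : ℕ} (Ω : Set (EuclideanSpace ℝ (Fin n))) : Type :=
  Lp (EuclideanSpace ℝ (Fin n)) 2 (volume.restrict Ω)

/-- Test functions: `φ ∈ C_c^∞(Ω)`, extended by zero to `ℝⁿ`. -/
structure IsTestFunction {n : ℕ} (Ω : Set (EuclideanSpace ℝ (Fin n)))
    (φ : EuclideanSpace ℝ (Fin n) → ℝ) : Prop where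
  contDiff : ContDiff ℝ (⊤ : ℕ∞) φ
  hasCompactSupport : HasCompactSupport φ
  tsupport_subset : tsupport φ ⊆ Ω

namespace IsTestFunction

variable {n : ℕ} {Ω : Set (EuclideanSpace ℝ (Fin n))} {φ ψ : EuclideanSpace ℝ (Fin n) → ℝ}

theorem zero : IsTestFunction Ω (fun _ => (0 : ℝ)) :=
  ⟨contDiff_const, HasCompactSupport.zero, by simp [tsupport]⟩

theorem add (hφ : IsTestFunction Ω φ) (hψ : IsTestFunction Ω ψ) :
    IsTestFunction Ω (fun x => φ x + ψ x) :=
  ⟨hφ.contDiff.add hψ.contDiff, hφ.hasCompactSupport.add hψ.hasCompactSupport,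
    (tsupport_add φ ψ).trans (Set.union_subset hφ.tsupport_subset hψ.tsupport_subset)⟩

theorem const_mul (c : ℝ) (hφ : IsTestFunction Ω φ) : IsTestFunction Ω (fun x => c * φ x) :=
  ⟨contDiff_const.mul hφ.contDiff, hφ.hasCompactSupport.mul_left,
    (tsupport_mul_subset_right (f := fun _ => c) (g := φ)).trans hφ.tsupport_subset⟩

theorem differentiable (hφ : IsTestFunction Ω φ) : Differentiable ℝ φ :=
  hφ.contDiff.differentiable (by simp)

theorem gradient_fun_add (hφ : IsTestFunction Ω φ) (hψ : IsTestFunction Ω ψ)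
    (x : EuclideanSpace ℝ (Fin n)) :
    gradient (fun x => φ x + ψ x) x = gradient φ x + gradient ψ x := by
  simp [gradient, fderiv_fun_add (hφ.differentiable x) (hψ.differentiable x)]

theorem gradient_fun_const_mul (c : ℝ) (hφ : IsTestFunction Ω φ)
    (x : EuclideanSpace ℝ (Fin n)) :
    gradient (fun x => c * φ x) x = c • gradient φ x := by
  simp [gradient, fderiv_const_mul (hφ.differentiable x)]

theorem memLp (hφ : IsTestFunction Ω φ) : MemLp φ 2 (volume.restrict Ω) :=
  (hφ.contDiff.continuous.memLp_of_hasCompactSupport hφ.hasCompactSupport).restrict Ω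

theorem memLp_gradient (hφ : IsTestFunction Ω φ) :
    MemLp (gradient φ) 2 (volume.restrict Ω) := by
  have hc : Continuous (gradient φ) :=
    (InnerProductSpace.toDual ℝ (EuclideanSpace ℝ (Fin n))).symm.continuous.comp
      (hφ.contDiff.continuous_fderiv (by simp))
  have hs : HasCompactSupport (gradient φ) :=
    (hφ.hasCompactSupport.fderiv (𝕜 := ℝ)).comp_left
      (g := (InnerProductSpace.toDual ℝ (EuclideanSpace ℝ (Fin n))).symm) (map_zero _)
  exact (hc.memLp_of_hasCompactSupport hs).restrict Ω

theorem integrable_inner_gradient (hφ : IsTestFunction Ω φ) (g : L2Vector Ω) :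
    Integrable (fun x => inner ℝ (g x) (gradient φ x)) (volume.restrict Ω) := by
  refine (L2.integrable_inner (𝕜 := ℝ) g hφ.memLp_gradient.toLp).congr ?_
  filter_upwards [hφ.memLp_gradient.coeFn_toLp] with x hx
  rw [hx]

end IsTestFunction

/-- The pairs `(φ, ∇φ)` with `φ ∈ C_c^∞(Ω)`, as a subspace of `L²(Ω) × L²(Ω; ℝⁿ)`. -/
def testGraph {n : ℕ} (Ω : Set (EuclideanSpace ℝ (Fin n))) :
    Submodule ℝ (L2Scalar Ω × L2Vector Ω) where
  carrier := {p | ∃ φ : EuclideanSpace ℝ (Fin n) → ℝ, IsTestFunction Ω φ ∧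
    p.1 =ᵐ[volume.restrict Ω] φ ∧ p.2 =ᵐ[volume.restrict Ω] gradient φ}
  zero_mem' := by
    refine ⟨fun _ => 0, IsTestFunction.zero, Lp.coeFn_zero _ _ _, ?_⟩
    rw [gradient_fun_const']
    exact Lp.coeFn_zero _ _ _
  add_mem' := by
    rintro p q ⟨φ, hφ, h1, h2⟩ ⟨ψ, hψ, h3, h4⟩
    refine ⟨_, hφ.add hψ, ?_, ?_⟩
    · filter_upwards [Lp.coeFn_add p.1 q.1, h1, h3] with x hx h1 h3
      simp only [Prod.fst_add, hx, Pi.add_apply, h1, h3]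
    · filter_upwards [Lp.coeFn_add p.2 q.2, h2, h4] with x hx h2 h4
      simp only [Prod.snd_add, hx, Pi.add_apply, h2, h4, hφ.gradient_fun_add hψ]
  smul_mem' := by
    rintro c p ⟨φ, hφ, h1, h2⟩
    refine ⟨_, hφ.const_mul c, ?_, ?_⟩
    · filter_upwards [Lp.coeFn_smul c p.1, h1] with x hx h1
      simp only [Prod.smul_fst, hx, Pi.smul_apply, smul_eq_mul, h1]
    · filter_upwards [Lp.coeFn_smul c p.2, h2] with x hx h2
      simp only [Prod.smul_snd, hx, Pi.smul_apply, h2, hφ.gradient_fun_const_mul]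

/-- The pairs `(u, ∇u)` with `u ∈ H¹₀(Ω)`: the closure of the pairs `(φ, ∇φ)`,
`φ ∈ C_c^∞(Ω)`, in `L²(Ω) × L²(Ω; ℝⁿ)`. -/
noncomputable def sobolevGraph {n : ℕ} (Ω : Set (EuclideanSpace ℝ (Fin n))) :
    Submodule ℝ (L2Scalar Ω × L2Vector Ω) :=
  (testGraph Ω).topologicalClosure

/-- The space of solutions `u ∈ H¹₀(Ω)` of the Dirichlet problem `Δu = -ν u` in `Ω`, `u = 0` on
`∂Ω`, in the weak sense: `∫_Ω ∇u · ∇φ = ν ∫_Ω u φ` for all `φ ∈ C_c^∞(Ω)`. -/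
def dirichletEigenspace {n : ℕ} (Ω : Set (EuclideanSpace ℝ (Fin n))) (ν : ℝ) :
    Submodule ℝ (L2Scalar Ω) where
  carrier := {u | ∃ g : L2Vector Ω, (u, g) ∈ sobolevGraph Ω ∧
    ∀ φ : EuclideanSpace ℝ (Fin n) → ℝ, IsTestFunction Ω φ →
      ∫ x in Ω, inner ℝ (g x) (gradient φ x) = ν * ∫ x in Ω, u x * φ x}
  zero_mem' := by
    refine ⟨0, (sobolevGraph Ω).zero_mem, fun φ _ => ?_⟩
    have h1 : ∫ x in Ω, inner ℝ ((0 : L2Vector Ω) x) (gradient φ x) = 0 := by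
      refine integral_eq_zero_of_ae ?_
      filter_upwards [Lp.coeFn_zero (EuclideanSpace ℝ (Fin n)) 2 (volume.restrict Ω)] with x hx
      rw [hx, Pi.zero_apply, inner_zero_left, Pi.zero_apply]
    have h2 : ∫ x in Ω, (0 : L2Scalar Ω) x * φ x = 0 := by
      refine integral_eq_zero_of_ae ?_
      filter_upwards [Lp.coeFn_zero ℝ 2 (volume.restrict Ω)] with x hx
      simp only [hx, Pi.zero_apply, zero_mul]
    rw [h1, h2, mul_zero]
  add_mem' := by
    rintro u v ⟨g, hg, h1⟩ ⟨w, hw, h2⟩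
    refine ⟨g + w, (sobolevGraph Ω).add_mem hg hw, fun φ hφ => ?_⟩
    have e1 : ∫ x in Ω, inner ℝ ((g + w : L2Vector Ω) x) (gradient φ x) =
        (∫ x in Ω, inner ℝ (g x) (gradient φ x)) + ∫ x in Ω, inner ℝ (w x) (gradient φ x) := by
      rw [← integral_add (hφ.integrable_inner_gradient g) (hφ.integrable_inner_gradient w)]
      refine integral_congr_ae ?_
      filter_upwards [Lp.coeFn_add g w] with x hx
      rw [hx, Pi.add_apply, inner_add_left]
    have e2 : ∫ x in Ω, (u + v : L2Scalar Ω) x * φ x =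
        (∫ x in Ω, u x * φ x) + ∫ x in Ω, v x * φ x := by
      rw [← integral_add (f := fun x => u x * φ x) (g := fun x => v x * φ x)
        ((Lp.memLp u).integrable_mul hφ.memLp) ((Lp.memLp v).integrable_mul hφ.memLp)]
      refine integral_congr_ae ?_
      filter_upwards [Lp.coeFn_add u v] with x hx
      rw [hx, Pi.add_apply, add_mul]
    rw [e1, e2, h1 φ hφ, h2 φ hφ, mul_add]
  smul_mem' := by
    rintro c u ⟨g, hg, h1⟩
    refine ⟨c • g, (sobolevGraph Ω).smul_mem c hg, fun φ hφ => ?_⟩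
    have e1 : ∫ x in Ω, inner ℝ ((c • g : L2Vector Ω) x) (gradient φ x) =
        c * ∫ x in Ω, inner ℝ (g x) (gradient φ x) := by
      rw [← integral_const_mul]
      refine integral_congr_ae ?_
      filter_upwards [Lp.coeFn_smul c g] with x hx
      rw [hx, Pi.smul_apply, real_inner_smul_left]
    have e2 : ∫ x in Ω, (c • u : L2Scalar Ω) x * φ x = c * ∫ x in Ω, u x * φ x := by
      rw [← integral_const_mul]
      refine integral_congr_ae ?_
      filter_upwards [Lp.coeFn_smul c u] with x hx
      rw [hx, Pi.smul_apply, smul_eq_mul, mul_assoc]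
    rw [e1, e2, h1 φ hφ]
    ring

/-- The `k`-th Dirichlet eigenvalue `λ_k(Ω)` (`k = 1, 2, …`) in the nondecreasing enumeration
in which each eigenvalue is repeated according to its multiplicity: the least `μ` such that the
eigenvalues `ν ≤ μ`, counted with the dimensions of their eigenspaces, number at least `k`. -/
noncomputable def dirichletEigenvalue {n : ℕ} (Ω : Set (EuclideanSpace ℝ (Fin n))) (k : ℕ) : ℝ :=
  sInf {μ : ℝ | (k : Cardinal) ≤
    Module.rank ℝ ↥(⨆ ν : ℝ, ⨆ _ : ν ≤ μ, dirichletEigenspace Ω ν)}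

/-- `C` is a constant in the inequality `λ_{k+1} ≤ C k^{2/n} λ_1`, valid for all bounded domains
of `ℝⁿ` and all `k ≥ 1`. -/
def IsChengYangConstant (n : ℕ) (C : ℝ) : Prop :=
  ∀ Ω : Set (EuclideanSpace ℝ (Fin n)), IsBoundedDomain Ω → ∀ k : ℕ, 1 ≤ k →
    dirichletEigenvalue Ω (k + 1) ≤ C * (k : ℝ) ^ ((2 : ℝ) / n) * dirichletEigenvalue Ω 1

/-- The optimal constant `C₀(n)` in the inequality `λ_{k+1} ≤ C₀(n) k^{2/n} λ_1`. -/
noncomputable def chengYangConstant (n : ℕ) : ℝ :=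
  sInf {C : ℝ | IsChengYangConstant n C}

/-!
Let `u` be an eigenfunction for the eigenvalue `κ` and `F` a function of one variable. The function
`F(x_p) u` lies in `H¹₀(Ω)`, and `(-Δ - κ) (F(x_p) u) = -2 F'(x_p) ∂_p u - F''(x_p) u`, so the
expansion of `F(x_p) u` in the eigenbasis determines that of the right hand side.

For `F(t) = t` this gives Yang's inequality after summation over `p`, and Yang's inequality forces
`λ_{k+1} ≤ (1 + 4/n) k^{2/n} λ_1`: the quantity `F_k` of Cheng and Yang, built from the first two
moments of the first `k` eigenvalues, satisfies `F_{k+1} ≤ ((k+1)/k)^{4/n} F_k`.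

For the gaps, put `A = λ_k - λ_1` and `B = λ_{k+1} - λ_1`. No eigenvalue lies strictly between
`λ_k` and `λ_{k+1}`, so the form `(-Δ - λ_k)(-Δ - λ_{k+1})` is nonnegative. Testing it on
`cos(α x_p) u_1` and `sin(α x_p) u_1`, whose contributions combine into a quantity independent of
the position, and summing over `p`, gives `(A + B) α² ≤ 4 λ_1 α² / n + α⁴ + A B`. The choice
`α² = √(A B)` yields `(√B - √A)² ≤ 4 λ_1 / n`, hence `λ_{k+1} - λ_k ≤ 4 √(λ_1 λ_{k+1} / n)`, and
the Cheng–Yang inequality bounds `λ_{k+1}`.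
-/

/-! ### Growth of sequences satisfying Yang's inequality -/

section YangRecursion

open Finset

theorem sum_ascPochhammer_div_factorial_mul_pow_le {a y : ℝ} (ha : 0 < a) (hy0 : 0 ≤ y)
    (hy1 : y < 1) (N : ℕ) :
    ∑ j ∈ range N, (ascPochhammer ℝ j).eval a / j.factorial * y ^ j ≤ ((1 - y) ^ a)⁻¹ := by
  have hcoeff : ∀ j : ℕ, Ring.choose (a + j - 1) j = (ascPochhammer ℝ j).eval a / j.factorial := by
    intro j
    have h := Ring.factorial_nsmul_multichoose_eq_ascPochhammer a j
    rw [Polynomial.ascPochhammer_smeval_eq_eval, nsmul_eq_mul, Ring.multichoose_eq] at h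
    rw [← h, mul_div_cancel_left₀ _ (Nat.cast_ne_zero.2 j.factorial_ne_zero)]
  have hseries := (Real.one_div_one_sub_rpow_hasFPowerSeriesOnBall_zero a).hasSum
    (y := y) (by simpa [enorm_eq_nnnorm, ← NNReal.coe_lt_coe, abs_of_nonneg hy0] using hy1)
  simp only [FormalMultilinearSeries.ofScalars_apply_eq, hcoeff, smul_eq_mul, zero_add, one_div]
    at hseries
  exact sum_le_hasSum _ (fun j _ ↦ mul_nonneg
    (div_nonneg (ascPochhammer_pos j a ha).le (Nat.cast_nonneg _)) (pow_nonneg hy0 j)) hseries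

theorem cubic_le_one_sub_rpow_inv {a y : ℝ} (ha : 0 < a) (hy0 : 0 ≤ y) (hy1 : y < 1) :
    1 + a * y + a * (a + 1) / 2 * y ^ 2 + a * (a + 1) * (a + 2) / 6 * y ^ 3 ≤
      ((1 - y) ^ a)⁻¹ := by
  simpa [sum_range_succ, ascPochhammer_succ_eval, Nat.factorial] using
    sum_ascPochhammer_div_factorial_mul_pow_le ha hy0 hy1 4

theorem yang_recursion_coefficient_le {s k : ℝ} (hs : 0 < s) (hk : 1 ≤ k) :
    (k + 1) ^ 2 + 2 * s * (k + 1) + s * (1 + 2 * s) + s * (1 + s) * (1 + 2 * s) / (2 * k + 1) ≤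
      (k + 1) ^ 2 * ((k + 1) / k) ^ (2 * s) := by
  have : 0 < k := by linarith
  have hy1 : 1 / (k + 1) < 1 := by rw [div_lt_one] <;> linarith
  have hcubic := cubic_le_one_sub_rpow_inv (a := 2 * s) (by positivity)
    (by positivity : 0 ≤ 1 / (k + 1)) hy1
  have hbase : ((1 - 1 / (k + 1)) ^ (2 * s))⁻¹ = ((k + 1) / k) ^ (2 * s) := by
    rw [← Real.inv_rpow (by linarith), one_sub_div (by positivity), add_sub_cancel_right, inv_div]
  have hfrac : 1 / (2 * k + 1) ≤ 2 / (3 * (k + 1)) := by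
    rw [div_le_div_iff₀ (by positivity) (by positivity)]
    linarith
  calc (k + 1) ^ 2 + 2 * s * (k + 1) + s * (1 + 2 * s) + s * (1 + s) * (1 + 2 * s) / (2 * k + 1)
      = (k + 1) ^ 2 + 2 * s * (k + 1) + s * (1 + 2 * s) +
          s * (1 + s) * (1 + 2 * s) * (1 / (2 * k + 1)) := by ring
    _ ≤ (k + 1) ^ 2 + 2 * s * (k + 1) + s * (1 + 2 * s) +
          s * (1 + s) * (1 + 2 * s) * (2 / (3 * (k + 1))) := by gcongr
    _ = (k + 1) ^ 2 * (1 + 2 * s * (1 / (k + 1)) + 2 * s * (2 * s + 1) / 2 * (1 / (k + 1)) ^ 2 +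
          2 * s * (2 * s + 1) * (2 * s + 2) / 6 * (1 / (k + 1)) ^ 3) := by field_simp; ring
    _ ≤ (k + 1) ^ 2 * ((k + 1) / k) ^ (2 * s) := by rw [← hbase]; gcongr

/-- Yang's inequality for a sequence `l`, numbered from `0`. The Dirichlet eigenvalues of a domain
of `ℝⁿ` satisfy it with `s = 2 / n`. -/
def YangInequality (s : ℝ) (l : ℕ → ℝ) : Prop :=
  ∀ k, ∑ i ∈ range k, (l k - l i) ^ 2 ≤ 2 * s * ∑ i ∈ range k, (l k - l i) * l i

/-- The average of the first `k` terms of `l`. -/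
noncomputable def firstMean (l : ℕ → ℝ) (k : ℕ) : ℝ :=
  (∑ i ∈ range k, l i) / k

/-- The quantity `F_k` of Cheng and Yang, a combination of the first two moments of the first `k`
terms of `l` which controls `l k` when `l` satisfies Yang's inequality. -/
noncomputable def yangDefect (s : ℝ) (l : ℕ → ℝ) (k : ℕ) : ℝ :=
  (1 + s) * firstMean l k ^ 2 - firstMean (fun i ↦ l i ^ 2) k

theorem yangDefect_one (s : ℝ) (l : ℕ → ℝ) : yangDefect s l 1 = s * l 0 ^ 2 := by
  simp only [yangDefect, firstMean, range_one, sum_singleton, Nat.cast_one, div_one]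
  ring

theorem sq_mul_yangDefect_succ (s : ℝ) (l : ℕ → ℝ) {k : ℕ} (hk : k ≠ 0) :
    ((k : ℝ) + 1) ^ 2 * yangDefect s l (k + 1) =
      -(k * (1 + s) * firstMean l k ^ 2) + 2 * (1 + s) * k * firstMean l k * l k +
        (s - k) * l k ^ 2 + k * (k + 1) * yangDefect s l k := by
  simp only [yangDefect, firstMean, sum_range_succ, Nat.cast_add, Nat.cast_one]
  field_simp
  ring

theorem yang_quadratic_form_le {s k x G F : ℝ} (hs : 0 < s) (hk : 0 ≤ k)
    (hY : x ^ 2 - 2 * (1 + s) * x * G + (1 + 2 * s) * (1 + s) * G ^ 2 ≤ (1 + 2 * s) * F) :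
    -(k * (1 + s) * G ^ 2) + 2 * (1 + s) * k * G * x + (s - k) * x ^ 2 + k * (k + 1) * F ≤
      ((k + 1) ^ 2 + 2 * s * (k + 1) + s * (1 + 2 * s) +
        s * (1 + s) * (1 + 2 * s) / (2 * k + 1)) * F := by
  obtain ⟨e, he⟩ : ∃ e, e = s * (1 + s) / (2 * k + 1) := ⟨_, rfl⟩
  -- `hY` is used with the weight `m - k`: the remaining form is a sum of squares up to `m - s`.
  obtain ⟨m, hm⟩ : ∃ m, m = 2 * k + 1 + s + e := ⟨_, rfl⟩
  have he0 : 0 < e := by rw [he]; positivity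
  have hde : (2 * k + 1) * e = s * (1 + s) := by rw [he]; field_simp
  have hms : 0 < m - s := by rw [hm]; linarith
  have hsquares : (m - s) * ((m - s) * x ^ 2 - 2 * (1 + s) * m * x * G +
      (1 + s) * (m * (1 + 2 * s) - 2 * s * k) * G ^ 2) =
      ((m - s) * x - (1 + s) * m * G) ^ 2 + (1 + s) * s * e ^ 2 * G ^ 2 := by
    rw [hm]
    linear_combination (1 + s) * s * G ^ 2 * hde
  have hform : 0 ≤ (m - s) * x ^ 2 - 2 * (1 + s) * m * x * G +
      (1 + s) * (m * (1 + 2 * s) - 2 * s * k) * G ^ 2 :=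
    nonneg_of_mul_nonneg_right (hsquares ▸ by positivity) hms
  have hweighted := mul_le_mul_of_nonneg_left hY (by rw [hm]; linarith : 0 ≤ m - k)
  have hcoeff : (k + 1) ^ 2 + 2 * s * (k + 1) + s * (1 + 2 * s) +
      s * (1 + s) * (1 + 2 * s) / (2 * k + 1) = k * (k + 1) + (m - k) * (1 + 2 * s) := by
    rw [hm, he]
    ring
  rw [hcoeff]
  linarith

namespace YangInequality

variable {s : ℝ} {l : ℕ → ℝ} {k : ℕ}

theorem quadratic_le (hY : YangInequality s l) (hk : k ≠ 0) :
    l k ^ 2 - 2 * (1 + s) * l k * firstMean l k + (1 + 2 * s) * (1 + s) * firstMean l k ^ 2 ≤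
      (1 + 2 * s) * yangDefect s l k := by
  have hk0 : (0 : ℝ) < k := by positivity
  have hsq : ∑ i ∈ range k, (l k - l i) ^ 2 =
      k * (l k ^ 2 - 2 * l k * firstMean l k + firstMean (fun i ↦ l i ^ 2) k) := by
    simp only [firstMean, sub_sq, sum_add_distrib, sum_sub_distrib, ← mul_sum, sum_const,
      card_range, nsmul_eq_mul]
    field_simp
  have hmul : ∑ i ∈ range k, (l k - l i) * l i =
      k * (l k * firstMean l k - firstMean (fun i ↦ l i ^ 2) k) := by
    simp only [firstMean, sub_mul, sum_sub_distrib, ← mul_sum, ← pow_two]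
    field_simp
  have h := hY k
  rw [hsq, hmul, mul_left_comm] at h
  have := le_of_mul_le_mul_left h hk0
  rw [yangDefect]
  linarith

theorem yangDefect_nonneg (hY : YangInequality s l) (hs : 0 ≤ s) (hk : k ≠ 0) :
    0 ≤ yangDefect s l k := by
  have hsquares : 0 ≤ (l k - (1 + s) * firstMean l k) ^ 2 + s * (1 + s) * firstMean l k ^ 2 := by
    positivity
  have : 0 ≤ (1 + 2 * s) * yangDefect s l k := by linarith [hY.quadratic_le hk]
  exact nonneg_of_mul_nonneg_right this (by positivity)

theorem yangDefect_succ_le (hY : YangInequality s l) (hs : 0 < s) (hk : k ≠ 0) :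
    yangDefect s l (k + 1) ≤ (((k : ℝ) + 1) / k) ^ (2 * s) * yangDefect s l k := by
  have hk1 : (1 : ℝ) ≤ k := by exact_mod_cast Nat.one_le_iff_ne_zero.2 hk
  refine le_of_mul_le_mul_left ?_ (by positivity : 0 < ((k : ℝ) + 1) ^ 2)
  rw [sq_mul_yangDefect_succ s l hk, ← mul_assoc]
  exact (yang_quadratic_form_le hs k.cast_nonneg (hY.quadratic_le hk)).trans
    (mul_le_mul_of_nonneg_right (yang_recursion_coefficient_le hs hk1)
      (hY.yangDefect_nonneg hs.le hk))

theorem yangDefect_le (hY : YangInequality s l) (hs : 0 < s) (hk : k ≠ 0) :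
    yangDefect s l k ≤ ((k : ℝ) ^ s) ^ 2 * (s * l 0 ^ 2) := by
  rw [← Real.rpow_mul_natCast k.cast_nonneg, Nat.cast_two, mul_comm s 2]
  induction k, Nat.one_le_iff_ne_zero.2 hk using Nat.le_induction with
  | base => simp [yangDefect_one]
  | succ k hk1 ih =>
    have hk0 : (0 : ℝ) < k := by exact_mod_cast hk1
    calc yangDefect s l (k + 1)
        ≤ (((k : ℝ) + 1) / k) ^ (2 * s) * yangDefect s l k :=
          hY.yangDefect_succ_le hs (by omega)
      _ ≤ (((k : ℝ) + 1) / k) ^ (2 * s) * ((k : ℝ) ^ (2 * s) * (s * l 0 ^ 2)) := by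
          gcongr
          exact ih (by omega)
      _ = ((k + 1 : ℕ) : ℝ) ^ (2 * s) * (s * l 0 ^ 2) := by
          rw [← mul_assoc, ← Real.mul_rpow (by positivity) hk0.le, div_mul_cancel₀ _ hk0.ne',
            Nat.cast_succ]

theorem mul_sq_le_yangDefect (hY : YangInequality s l) (hs : 0 ≤ s) (hk : k ≠ 0) :
    s * l k ^ 2 ≤ (1 + 2 * s) ^ 2 * yangDefect s l k := by
  have hscaled := mul_le_mul_of_nonneg_left (hY.quadratic_le hk) (by positivity : 0 ≤ 1 + 2 * s)
  have hsquare : 0 ≤ (1 + s) * ((1 + 2 * s) * firstMean l k - l k) ^ 2 := by positivity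
  linarith

theorem le_mul_rpow (hY : YangInequality s l) (hs : 0 < s) (h0 : 0 ≤ l 0) (hk : k ≠ 0) :
    l k ≤ (1 + 2 * s) * (k : ℝ) ^ s * l 0 := by
  refine le_of_sq_le_sq (le_of_mul_le_mul_left ?_ hs) (by positivity)
  calc s * l k ^ 2 ≤ (1 + 2 * s) ^ 2 * yangDefect s l k := hY.mul_sq_le_yangDefect hs.le hk
    _ ≤ (1 + 2 * s) ^ 2 * (((k : ℝ) ^ s) ^ 2 * (s * l 0 ^ 2)) := by
        gcongr
        exact hY.yangDefect_le hs hk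
    _ = s * ((1 + 2 * s) * (k : ℝ) ^ s * l 0) ^ 2 := by ring

end YangInequality

end YangRecursion

/-! ### Spectral sum rules -/

section SumRules

variable {ι H : Type*} [NormedAddCommGroup H] [InnerProductSpace ℝ H]

theorem hasSum_real_inner_mul_inner (b : HilbertBasis ι ℝ H) (x y : H) :
    HasSum (fun j ↦ inner ℝ x (b j) * inner ℝ y (b j)) (inner ℝ x y) := by
  simpa only [real_inner_comm y] using b.hasSum_inner_mul_inner x y

theorem hasSum_real_inner_sq (b : HilbertBasis ι ℝ H) (x : H) :
    HasSum (fun j ↦ inner ℝ x (b j) ^ 2) (‖x‖ ^ 2) := by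
  simpa only [← sq, real_inner_self_eq_norm_sq] using hasSum_real_inner_mul_inner b x x

/-- With `f i j = (μ - l i) (μ - l j) (l j - l i) ⟪w i, b j⟫ ^ 2`, the difference of the two sides
is minus the sum of `f i j` over `i ∈ s` and all `j`. The part with `j ∈ s` vanishes because `f` is
antisymmetric, and the terms with `j ∉ s` are nonpositive. -/
theorem sum_sq_mul_inner_le_sum_mul_norm_sq (b : HilbertBasis ι ℝ H) {l : ι → ℝ} {s : Finset ι}
    {μ : ℝ} (hs : ∀ i ∈ s, l i ≤ μ) (hsc : ∀ j ∉ s, μ ≤ l j) {w z : ι → H}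
    (hw : ∀ i j, inner ℝ (w i) (b j) = inner ℝ (w j) (b i))
    (hz : ∀ i j, inner ℝ (z i) (b j) = (l j - l i) * inner ℝ (w i) (b j)) :
    ∑ i ∈ s, (μ - l i) ^ 2 * inner ℝ (w i) (z i) ≤ ∑ i ∈ s, (μ - l i) * ‖z i‖ ^ 2 := by
  obtain ⟨f, hf⟩ : ∃ f : ι → ι → ℝ, ∀ i j,
      f i j = (μ - l i) * (μ - l j) * (l j - l i) * inner ℝ (w i) (b j) ^ 2 :=
    ⟨_, fun _ _ ↦ rfl⟩
  have hsum : ∀ i, HasSum (f i)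
      ((μ - l i) ^ 2 * inner ℝ (w i) (z i) - (μ - l i) * ‖z i‖ ^ 2) := by
    intro i
    refine (((hasSum_real_inner_mul_inner b (w i) (z i)).mul_left ((μ - l i) ^ 2)).sub
      ((hasSum_real_inner_sq b (z i)).mul_left (μ - l i))).congr_fun fun j ↦ ?_
    rw [hf, hz]
    ring
  have hnonpos : ∀ j ∉ s, ∑ i ∈ s, f i j ≤ 0 := by
    refine fun j hj ↦ Finset.sum_nonpos fun i hi ↦ ?_
    rw [hf]
    refine mul_nonpos_of_nonpos_of_nonneg (mul_nonpos_of_nonpos_of_nonneg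
      (mul_nonpos_of_nonneg_of_nonpos ?_ ?_) ?_) (sq_nonneg _) <;> linarith [hs i hi, hsc j hj]
  have hzero : ∑ j ∈ s, ∑ i ∈ s, f i j = 0 := by
    have hanti : ∑ j ∈ s, ∑ i ∈ s, f i j = -∑ j ∈ s, ∑ i ∈ s, f i j := by
      conv_rhs => rw [Finset.sum_comm]
      simp only [← Finset.sum_neg_distrib]
      refine Finset.sum_congr rfl fun j _ ↦ Finset.sum_congr rfl fun i _ ↦ ?_
      rw [hf, hf, hw j i]
      ring
    linarith
  have htotal := sum_le_hasSum s (fun j hj ↦ neg_nonneg.2 (hnonpos j hj))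
    (hasSum_sum (s := s) fun i _ ↦ hsum i).neg
  rw [Finset.sum_neg_distrib, hzero, Finset.sum_sub_distrib] at htotal
  linarith

/-- The left hand side is the sum over `j` of `(l j - A) (l j - B) ⟪w, b j⟫ ^ 2`. -/
theorem norm_sq_sub_mul_inner_add_nonneg (b : HilbertBasis ι ℝ H) {l : ι → ℝ} {A B c : ℝ}
    (hAB : A ≤ B) (hgap : ∀ j, l j ≤ A ∨ B ≤ l j) {w z : H}
    (hz : ∀ j, inner ℝ z (b j) = (l j - c) * inner ℝ w (b j)) :
    0 ≤ ‖z‖ ^ 2 - ((A - c) + (B - c)) * inner ℝ w z + (A - c) * (B - c) * ‖w‖ ^ 2 := by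
  have hsum := ((hasSum_real_inner_sq b z).sub
    ((hasSum_real_inner_mul_inner b w z).mul_left ((A - c) + (B - c)))).add
    ((hasSum_real_inner_sq b w).mul_left ((A - c) * (B - c)))
  refine hsum.nonneg fun j ↦ ?_
  have hterm : inner ℝ z (b j) ^ 2 -
      (A - c + (B - c)) * (inner ℝ w (b j) * inner ℝ z (b j)) +
      (A - c) * (B - c) * inner ℝ w (b j) ^ 2 =
      (l j - A) * (l j - B) * inner ℝ w (b j) ^ 2 := by
    rw [hz]
    ring
  rw [hterm]
  refine mul_nonneg ?_ (sq_nonneg _)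
  rcases hgap j with h | h
  · exact mul_nonneg_of_nonpos_of_nonpos (by linarith) (by linarith)
  · exact mul_nonneg (by linarith) (by linarith)

/-- With `u` an eigenfunction, `(u₁, u₂)` and `(v₁, v₂)` stand for the products of `u` and of
`∂_p u` with `(cos (α x_p), sin (α x_p))`. In the sum of the inequalities
`norm_sq_sub_mul_inner_add_nonneg` for `u₁` and `u₂` the mixed terms cancel. -/
theorem add_mul_sq_le_of_rotation (b : HilbertBasis ι ℝ H) {l : ι → ℝ} {A B c α : ℝ} (hAB : A ≤ B)
    (hgap : ∀ j, l j ≤ A ∨ B ≤ l j) {u₁ u₂ v₁ v₂ : H} (hnorm : ‖u₁‖ ^ 2 + ‖u₂‖ ^ 2 = 1)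
    (hmixed : inner ℝ u₁ v₂ = inner ℝ u₂ v₁)
    (h₁ : ∀ j, inner ℝ (α ^ 2 • u₁ + (2 * α) • v₂) (b j) = (l j - c) * inner ℝ u₁ (b j))
    (h₂ : ∀ j, inner ℝ (α ^ 2 • u₂ - (2 * α) • v₁) (b j) = (l j - c) * inner ℝ u₂ (b j)) :
    ((A - c) + (B - c)) * α ^ 2 ≤
      4 * α ^ 2 * (‖v₁‖ ^ 2 + ‖v₂‖ ^ 2) + (α ^ 2) ^ 2 + (A - c) * (B - c) := by
  have hq₁ := norm_sq_sub_mul_inner_add_nonneg b hAB hgap h₁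
  have hq₂ := norm_sq_sub_mul_inner_add_nonneg b hAB hgap h₂
  simp only [norm_add_sq_real, norm_sub_sq_real, inner_add_right, inner_sub_right,
    real_inner_smul_left, real_inner_smul_right, real_inner_self_eq_norm_sq, norm_smul, mul_pow,
    Real.norm_eq_abs, sq_abs] at hq₁ hq₂
  rw [hmixed] at hq₁
  linear_combination hq₁ + hq₂ + ((α ^ 2) ^ 2 - (A - c + (B - c)) * α ^ 2 +
    (A - c) * (B - c)) * hnorm

end SumRules

theorem sqrt_sub_sqrt_sq_le {A B c : ℝ} (hA : 0 ≤ A) (hB : 0 ≤ B)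
    (h : ∀ t : ℝ, 0 < t → (A + B) * t ≤ c * t + t ^ 2 + A * B) :
    (√B - √A) ^ 2 ≤ c := by
  have hsq : (√A * √B) ^ 2 = A * B := by rw [mul_pow, Real.sq_sqrt hA, Real.sq_sqrt hB]
  have hexp : (√B - √A) ^ 2 = A + B - 2 * (√A * √B) := by
    rw [sub_sq, Real.sq_sqrt hA, Real.sq_sqrt hB]
    ring
  rw [hexp]
  rcases (by positivity : 0 ≤ √A * √B).eq_or_lt with h0 | ht
  · refine le_of_forall_pos_le_add fun t ht ↦ ?_
    rw [← h0] at hsq ⊢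
    exact le_of_mul_le_mul_right (by linarith [h t ht]) ht
  · exact le_of_mul_le_mul_right (by linarith [h _ ht]) ht

theorem sub_le_two_mul_sqrt_of_sqrt_sub_sqrt_sq_le {A B c : ℝ} (hA : 0 ≤ A) (hAB : A ≤ B)
    (h : (√B - √A) ^ 2 ≤ c) : B - A ≤ 2 * √(c * B) := by
  have hroot : √A ≤ √B := Real.sqrt_le_sqrt hAB
  calc B - A = (√B - √A) * (√B + √A) := by
        linear_combination -(Real.sq_sqrt (hA.trans hAB)) + Real.sq_sqrt hA
    _ ≤ √c * (√B + √B) := by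
        gcongr
        exact Real.le_sqrt_of_sq_le h
    _ = 2 * √(c * B) := by
        rw [Real.sqrt_mul ((sq_nonneg _).trans h)]
        ring

/-! ### Monotone enumeration -/

theorem exists_equiv_nat_monotone_of_finite_sublevel {ι α : Type*} [Infinite ι] [LinearOrder α]
    (f : ι → α) (hf : ∀ a, {i | f i ≤ a}.Finite) : ∃ e : ℕ ≃ ι, Monotone (f ∘ e) := by
  classical
  let : LinearOrder ι := linearOrderOfSTO WellOrderingRel
  let key : ι → α ×ₗ ι := fun i ↦ toLex (f i, i)
  have hfin : ∀ i, {j | key j < key i}.Finite := fun i ↦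
    (hf (f i)).subset fun j hj ↦ Prod.Lex.monotone_fst_ofLex (le_of_lt hj)
  let rank : ι → ℕ := fun i ↦ {j | key j < key i}.ncard
  have hrank : ∀ i j, key i < key j → rank i < rank j := fun i j hij ↦
    Set.ncard_lt_ncard ⟨fun k hk ↦ hk.trans hij, fun h ↦ lt_irrefl (key i) (h hij)⟩ (hfin j)
  have hinj : Function.Injective rank := by
    intro i j hij
    by_contra hne
    have hkey : key i ≠ key j := fun h ↦ hne (congrArg (fun p ↦ (ofLex p).2) h)
    rcases hkey.lt_or_gt with h | h
    · exact (hrank i j h).ne hij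
    · exact (hrank j i h).ne' hij
  have : Infinite (Set.range rank) := (Set.infinite_range_of_injective hinj).to_subtype
  let toRange := Nat.Subtype.orderIsoOfNat (Set.range rank)
  let ofRange := (Equiv.ofInjective rank hinj).symm
  refine ⟨toRange.toEquiv.trans ofRange, fun m n hmn ↦ ?_⟩
  have hmono : rank (ofRange (toRange m)) ≤ rank (ofRange (toRange n)) := by
    simp only [ofRange, Equiv.apply_ofInjective_symm]
    exact toRange.monotone hmn
  by_contra! hlt
  exact (hrank _ _ (Prod.Lex.toLex_lt_toLex.2 (.inl hlt))).not_ge hmono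

/-! ### A Rellich-type inequality -/

theorem eLpNorm_two_sq_eq_lintegral {α F : Type*} [MeasurableSpace α] [NormedAddCommGroup F]
    (f : α → F) (μ : Measure α) : eLpNorm f 2 μ ^ 2 = ∫⁻ x, ‖f x‖ₑ ^ 2 ∂μ := by
  simpa using eLpNorm_nnreal_pow_eq_lintegral (f := f) (μ := μ) (p := 2) two_ne_zero

theorem enorm_add_sq_le_two_mul {F : Type*} [SeminormedAddCommGroup F] (a b : F) :
    ‖a + b‖ₑ ^ 2 ≤ 2 * (‖a‖ₑ ^ 2 + ‖b‖ₑ ^ 2) := by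
  simp only [enorm_eq_nnnorm]
  exact_mod_cast (pow_le_pow_left₀ zero_le (nnnorm_add_le a b) 2).trans add_sq_le

theorem enorm_integral_sq_le {α F : Type*} [MeasurableSpace α] [NormedAddCommGroup F]
    [NormedSpace ℝ F] {μ : Measure α} [IsProbabilityMeasure μ] {f : α → F}
    (hf : AEStronglyMeasurable f μ) : ‖∫ x, f x ∂μ‖ₑ ^ 2 ≤ ∫⁻ x, ‖f x‖ₑ ^ 2 ∂μ := by
  rw [← eLpNorm_two_sq_eq_lintegral]
  gcongr
  calc ‖∫ x, f x ∂μ‖ₑ ≤ ∫⁻ x, ‖f x‖ₑ ∂μ := enorm_integral_le_lintegral_enorm f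
    _ = eLpNorm f 1 μ := eLpNorm_one_eq_lintegral_enorm.symm
    _ ≤ eLpNorm f 2 μ := eLpNorm_le_eLpNorm_of_exponent_le (by norm_num) hf

section Translation

variable {E F : Type*} [NormedAddCommGroup E] [NormedSpace ℝ E] [NormedAddCommGroup F]
  [NormedSpace ℝ F]

theorem enorm_translate_sub_sq_le [CompleteSpace F] {φ : E → F} (hφ : ContDiff ℝ 1 φ) (x z : E) :
    ‖φ (x + z) - φ x‖ₑ ^ 2 ≤
      ∫⁻ t in Set.Icc (0 : ℝ) 1, ‖z‖ₑ ^ 2 * ‖fderiv ℝ φ (x + t • z)‖ₑ ^ 2 := by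
  have hcont : Continuous fun t : ℝ ↦ fderiv ℝ φ (x + t • z) z := by
    have := hφ.continuous_fderiv one_ne_zero
    fun_prop
  have hderiv : ∀ t : ℝ, HasDerivAt (fun t : ℝ ↦ φ (x + t • z)) (fderiv ℝ φ (x + t • z) z) t :=
    fun t ↦ (hφ.differentiable one_ne_zero _).hasFDerivAt.comp_hasDerivAt t
      (by simpa using ((hasDerivAt_id t).smul_const z).const_add x)
  have hftc : φ (x + z) - φ x = ∫ t in Set.Icc (0 : ℝ) 1, fderiv ℝ φ (x + t • z) z := by
    rw [integral_Icc_eq_integral_Ioc, ← intervalIntegral.integral_of_le zero_le_one,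
      intervalIntegral.integral_eq_sub_of_hasDerivAt (fun t _ ↦ hderiv t)
        (hcont.intervalIntegrable _ _)]
    simp
  have : IsProbabilityMeasure (volume.restrict (Set.Icc (0 : ℝ) 1)) := ⟨by simp⟩
  rw [hftc]
  refine (enorm_integral_sq_le hcont.aestronglyMeasurable).trans (lintegral_mono fun t ↦ ?_)
  rw [← mul_pow, mul_comm]
  gcongr
  exact (fderiv ℝ φ (x + t • z)).le_opENorm z

variable [MeasurableSpace E] [BorelSpace E] [FiniteDimensional ℝ E] (μ : Measure E)
  [μ.IsAddHaarMeasure]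

theorem lintegral_enorm_translate_sub_sq_le [CompleteSpace F] {φ : E → F}
    (hφ : ContDiff ℝ 1 φ) (z : E) :
    ∫⁻ x, ‖φ (x + z) - φ x‖ₑ ^ 2 ∂μ ≤ ‖z‖ₑ ^ 2 * ∫⁻ x, ‖fderiv ℝ φ x‖ₑ ^ 2 ∂μ := by
  have hmeas : Measurable (Function.uncurry fun (x : E) (t : ℝ) ↦
      ‖z‖ₑ ^ 2 * ‖fderiv ℝ φ (x + t • z)‖ₑ ^ 2) := by
    have := hφ.continuous_fderiv one_ne_zero
    have : Continuous fun p : E × ℝ ↦ ‖fderiv ℝ φ (p.1 + p.2 • z)‖ₑ := by fun_prop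
    exact (this.measurable.pow_const 2).const_mul _
  calc ∫⁻ x, ‖φ (x + z) - φ x‖ₑ ^ 2 ∂μ
      ≤ ∫⁻ x, ∫⁻ t in Set.Icc (0 : ℝ) 1, ‖z‖ₑ ^ 2 * ‖fderiv ℝ φ (x + t • z)‖ₑ ^ 2 ∂volume ∂μ :=
        lintegral_mono fun x ↦ enorm_translate_sub_sq_le hφ x z
    _ = ∫⁻ t in Set.Icc (0 : ℝ) 1, ∫⁻ x, ‖z‖ₑ ^ 2 * ‖fderiv ℝ φ (x + t • z)‖ₑ ^ 2 ∂μ :=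
        lintegral_lintegral_swap hmeas.aemeasurable
    _ = ∫⁻ t in Set.Icc (0 : ℝ) 1, ‖z‖ₑ ^ 2 * ∫⁻ x, ‖fderiv ℝ φ x‖ₑ ^ 2 ∂μ := by
        refine lintegral_congr fun t ↦ ?_
        rw [lintegral_const_mul' _ _ (by simp),
          lintegral_add_right_eq_self (fun x ↦ ‖fderiv ℝ φ x‖ₑ ^ 2)]
    _ = ‖z‖ₑ ^ 2 * ∫⁻ x, ‖fderiv ℝ φ x‖ₑ ^ 2 ∂μ := by simp

theorem lintegral_lintegral_ball_sub_sq_le [CompleteSpace F] {φ : E → F}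
    (hφ : ContDiff ℝ 1 φ) (r : ℝ) :
    ∫⁻ x, ∫⁻ y in Metric.ball x r, ‖φ x - φ y‖ₑ ^ 2 ∂μ ∂μ ≤
      μ (Metric.ball 0 r) * (ENNReal.ofReal r ^ 2 * ∫⁻ x, ‖fderiv ℝ φ x‖ₑ ^ 2 ∂μ) := by
  have hshift : ∀ x, ∫⁻ y in Metric.ball x r, ‖φ x - φ y‖ₑ ^ 2 ∂μ =
      ∫⁻ z in Metric.ball 0 r, ‖φ (x + z) - φ x‖ₑ ^ 2 ∂μ := by
    intro x
    rw [← lintegral_indicator Metric.isOpen_ball.measurableSet,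
      ← lintegral_indicator Metric.isOpen_ball.measurableSet, ← lintegral_add_left_eq_self _ x]
    refine lintegral_congr fun z ↦ ?_
    simp only [Set.indicator, Metric.mem_ball, dist_zero_right, dist_self_add_left]
    rw [← enorm_neg, neg_sub]
  have hmeas : Measurable (Function.uncurry fun (x z : E) ↦ ‖φ (x + z) - φ x‖ₑ ^ 2) := by
    have hcont := hφ.continuous
    have : Continuous fun p : E × E ↦ ‖φ (p.1 + p.2) - φ p.1‖ₑ := by fun_prop
    exact this.measurable.pow_const 2
  simp_rw [hshift]
  rw [lintegral_lintegral_swap hmeas.aemeasurable]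
  calc ∫⁻ z in Metric.ball 0 r, ∫⁻ x, ‖φ (x + z) - φ x‖ₑ ^ 2 ∂μ ∂μ
      ≤ ∫⁻ _ in Metric.ball 0 r, ENNReal.ofReal r ^ 2 * ∫⁻ x, ‖fderiv ℝ φ x‖ₑ ^ 2 ∂μ ∂μ := by
        refine setLIntegral_mono' Metric.isOpen_ball.measurableSet fun z hz ↦ ?_
        refine (lintegral_enorm_translate_sub_sq_le μ hφ z).trans ?_
        gcongr
        rw [← ofReal_norm]
        exact ENNReal.ofReal_le_ofReal (mem_ball_zero_iff.1 hz).le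
    _ = μ (Metric.ball 0 r) * (ENNReal.ofReal r ^ 2 * ∫⁻ x, ‖fderiv ℝ φ x‖ₑ ^ 2 ∂μ) := by
        rw [setLIntegral_const, mul_comm]

theorem enorm_sub_average_sq_le [CompleteSpace F] {φ : E → F} (hφ : Continuous φ) {δ : ℝ}
    {x c : E} (hx : x ∈ Metric.ball c δ) :
    ‖φ x - ⨍ y in Metric.ball c δ, φ y ∂μ‖ₑ ^ 2 ≤
      (μ (Metric.ball 0 δ))⁻¹ * ∫⁻ y in Metric.ball x (2 * δ), ‖φ x - φ y‖ₑ ^ 2 ∂μ := by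
  obtain ⟨B, hB⟩ : ∃ B, B = Metric.ball c δ := ⟨_, rfl⟩
  have hB0 : μ B ≠ 0 := hB ▸ (Metric.isOpen_ball.measure_pos μ ⟨x, hx⟩).ne'
  have hvol : μ B = μ (Metric.ball 0 δ) := hB ▸ Measure.addHaar_ball_center μ c δ
  have hprob : IsProbabilityMeasure ((μ B)⁻¹ • μ.restrict B) :=
    ⟨by simp [ENNReal.inv_mul_cancel hB0 (hB ▸ measure_ball_lt_top.ne)]⟩
  have hint : Integrable φ ((μ B)⁻¹ • μ.restrict B) := by
    refine Integrable.smul_measure ?_ (ENNReal.inv_ne_top.2 hB0)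
    exact (hφ.continuousOn.integrableOn_compact (isCompact_closedBall c δ)).mono_set
      (hB ▸ Metric.ball_subset_closedBall)
  have hdev : φ x - ⨍ y in B, φ y ∂μ = ∫ y, (φ x - φ y) ∂((μ B)⁻¹ • μ.restrict B) := by
    rw [integral_sub (integrable_const _) hint, average, Measure.restrict_apply_univ]
    simp
  have hsub : B ⊆ Metric.ball x (2 * δ) := by
    intro y hy
    rw [hB, Metric.mem_ball] at hy
    rw [Metric.mem_ball] at hx ⊢
    linarith [dist_triangle_right y x c]
  rw [← hB, hdev]
  refine (enorm_integral_sq_le (by fun_prop)).trans ?_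
  rw [lintegral_smul_measure, hvol, smul_eq_mul]
  gcongr

theorem lintegral_enorm_sq_le_of_ball_cover [CompleteSpace F] {φ : E → F} (hφ : ContDiff ℝ 1 φ)
    {δ : ℝ} (hδ : 0 < δ) {Ω : Set E} (hΩ : MeasurableSet Ω) {s : Finset E}
    (hs : Ω ⊆ ⋃ c ∈ s, Metric.ball c δ) :
    ∫⁻ x in Ω, ‖φ x‖ₑ ^ 2 ∂μ ≤
      2 ^ (Module.finrank ℝ E + 1) * ENNReal.ofReal (2 * δ) ^ 2 * ∫⁻ x, ‖fderiv ℝ φ x‖ₑ ^ 2 ∂μ +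
        2 * μ Ω * ∑ c ∈ s, ‖⨍ y in Metric.ball c δ, φ y ∂μ‖ₑ ^ 2 := by
  set v := μ (Metric.ball (0 : E) δ)
  set D := ∫⁻ x, ‖fderiv ℝ φ x‖ₑ ^ 2 ∂μ
  set S := ∑ c ∈ s, ‖⨍ y in Metric.ball c δ, φ y ∂μ‖ₑ ^ 2
  have hv0 : v ≠ 0 := (Metric.measure_ball_pos μ 0 hδ).ne'
  have hvinv : v⁻¹ * v = 1 := ENNReal.inv_mul_cancel hv0 measure_ball_lt_top.ne
  have hvol : μ (Metric.ball (0 : E) (2 * δ)) = 2 ^ Module.finrank ℝ E * v := by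
    rw [Measure.addHaar_ball_mul_of_pos μ 0 two_pos, ENNReal.ofReal_pow zero_le_two,
      ENNReal.ofReal_ofNat]
  have hpt : ∀ x ∈ Ω, ‖φ x‖ₑ ^ 2 ≤
      2 * v⁻¹ * (∫⁻ y in Metric.ball x (2 * δ), ‖φ x - φ y‖ₑ ^ 2 ∂μ) + 2 * S := by
    intro x hx
    obtain ⟨c, hc, hxc⟩ : ∃ c ∈ s, x ∈ Metric.ball c δ := by simpa using hs hx
    have hsplit := enorm_add_sq_le_two_mul (φ x - ⨍ y in Metric.ball c δ, φ y ∂μ)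
      (⨍ y in Metric.ball c δ, φ y ∂μ)
    rw [sub_add_cancel] at hsplit
    refine hsplit.trans ?_
    rw [mul_add, mul_assoc]
    gcongr
    · exact enorm_sub_average_sq_le μ hφ.continuous hxc
    · exact Finset.single_le_sum (f := fun c ↦ ‖⨍ y in Metric.ball c δ, φ y ∂μ‖ₑ ^ 2)
        (fun _ _ ↦ zero_le) hc
  calc ∫⁻ x in Ω, ‖φ x‖ₑ ^ 2 ∂μ
      ≤ ∫⁻ x in Ω, (2 * v⁻¹ * (∫⁻ y in Metric.ball x (2 * δ), ‖φ x - φ y‖ₑ ^ 2 ∂μ) + 2 * S) ∂μ :=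
        setLIntegral_mono' hΩ hpt
    _ = 2 * v⁻¹ * (∫⁻ x in Ω, ∫⁻ y in Metric.ball x (2 * δ), ‖φ x - φ y‖ₑ ^ 2 ∂μ ∂μ) +
          2 * S * μ Ω := by
        rw [lintegral_add_right _ measurable_const, setLIntegral_const,
          lintegral_const_mul' _ _ (ENNReal.mul_ne_top (by simp) (ENNReal.inv_ne_top.2 hv0))]
    _ ≤ 2 * v⁻¹ * (2 ^ Module.finrank ℝ E * v * (ENNReal.ofReal (2 * δ) ^ 2 * D)) +
          2 * S * μ Ω := by
        gcongr
        exact hvol ▸ (setLIntegral_le_lintegral _ _).trans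
          (lintegral_lintegral_ball_sub_sq_le μ hφ (2 * δ))
    _ = (v⁻¹ * v) * (2 ^ (Module.finrank ℝ E + 1) * ENNReal.ofReal (2 * δ) ^ 2 * D) +
          2 * μ Ω * S := by ring
    _ = 2 ^ (Module.finrank ℝ E + 1) * ENNReal.ofReal (2 * δ) ^ 2 * D + 2 * μ Ω * S := by
        rw [hvinv, one_mul]

end Translation

/-! ### Compact operators -/

section CompactOperators

universe u

variable {𝕜 : Type u} {V H : Type*} [RCLike 𝕜] [NormedAddCommGroup V] [InnerProductSpace 𝕜 V]
  [NormedAddCommGroup H] [InnerProductSpace 𝕜 H]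

theorem isCompactOperator_of_small_on_finite_codim [CompleteSpace V] [CompleteSpace H]
    (A : V →L[𝕜] H)
    (h : ∀ ε > 0, ∃ s : Finset H, ∀ x, (∀ e ∈ s, inner 𝕜 e (A x) = 0) → ‖A x‖ ≤ ε * ‖x‖) :
    IsCompactOperator A := by
  classical
  suffices A ∈ closure {B : V →L[𝕜] H | IsCompactOperator B} from
    isClosed_setOfPred_isCompactOperator.closure_subset this
  rw [Metric.mem_closure_iff]
  intro ε hε
  obtain ⟨s, hs⟩ := h (ε / 2) (half_pos hε)
  let K : Submodule 𝕜 V := Submodule.span 𝕜 (s.image (ContinuousLinearMap.adjoint A) : Set V)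
  have : FiniteDimensional 𝕜 K := FiniteDimensional.span_finset 𝕜 _
  have hK : IsCompactOperator (A ∘L K.starProjection) :=
    (((isCompactOperator_id : IsCompactOperator (id : K → K)).clm_comp K.subtypeL).clm_comp
      A).comp_clm K.orthogonalProjectionOnto
  refine ⟨A ∘L K.starProjection, hK, ?_⟩
  rw [dist_eq_norm]
  refine (ContinuousLinearMap.opNorm_le_bound _ (half_pos hε).le fun x ↦ ?_).trans_lt
    (half_lt_self hε)
  have hx : x - K.starProjection x = Kᗮ.starProjection x := by
    simp [Submodule.starProjection_orthogonal']
  rw [sub_apply, ContinuousLinearMap.comp_apply, ← map_sub, hx]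
  refine (hs _ fun e he ↦ ?_).trans ?_
  · rw [← ContinuousLinearMap.adjoint_inner_left]
    refine Submodule.inner_right_of_mem_orthogonal (K := K)
      (Submodule.subset_span (by simpa using ⟨e, he, rfl⟩)) (Submodule.starProjection_apply_mem _ _)
  · gcongr
    simpa using Kᗮ.starProjection.le_of_opNorm_le (Submodule.starProjection_norm_le Kᗮ) x

theorem finite_setOf_le_norm_eigenvalue {T : H →L[𝕜] H} (hT : IsCompactOperator T) {ι : Type*}
    {v : ι → H} (hv : Orthonormal 𝕜 v) {m : ι → 𝕜} (hm : ∀ i, T (v i) = m i • v i) {c : ℝ}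
    (hc : 0 < c) : {i | c ≤ ‖m i‖}.Finite := by
  by_contra hinf
  let j := (show Set.Infinite {i | c ≤ ‖m i‖} from hinf).natEmbedding
  obtain ⟨y, -, φ, hφ, hlim⟩ := (hT.isCompact_closure_image_closedBall 1).tendsto_subseq
    (x := fun k ↦ T (v (j k))) fun k ↦ subset_closure ⟨v (j k), by simp [hv.1], rfl⟩
  obtain ⟨N, hN⟩ := Metric.cauchySeq_iff'.1 hlim.cauchySeq c hc
  have hclose := hN (N + 1) N.le_succ
  simp only [Function.comp_apply, dist_eq_norm] at hclose
  have hne : (j (φ (N + 1)) : ι) ≠ j (φ N) := fun h ↦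
    (hφ N.lt_succ_self).ne' (j.injective (Subtype.ext h))
  have hpyth : ‖T (v (j (φ (N + 1)))) - T (v (j (φ N)))‖ ^ 2 =
      ‖m (j (φ (N + 1)))‖ ^ 2 + ‖m (j (φ N))‖ ^ 2 := by
    rw [hm, hm, norm_sub_sq (𝕜 := 𝕜), inner_smul_left, inner_smul_right, hv.2 hne, norm_smul,
      norm_smul, hv.1, hv.1]
    simp
  have hfar : c ^ 2 ≤ ‖T (v (j (φ (N + 1)))) - T (v (j (φ N)))‖ ^ 2 := by
    rw [hpyth]
    have : c ^ 2 ≤ ‖m (j (φ (N + 1)))‖ ^ 2 := pow_le_pow_left₀ hc.le (j (φ (N + 1))).2 2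
    linarith [sq_nonneg ‖m (j (φ N))‖]
  exact hclose.not_ge (le_of_sq_le_sq hfar (norm_nonneg _))

theorem infinite_of_hilbertBasis {ι : Type*} (b : HilbertBasis ι 𝕜 H)
    (hH : ¬ FiniteDimensional 𝕜 H) : Infinite ι := by
  by_contra hfin
  rw [not_infinite_iff_finite] at hfin
  have := Fintype.ofFinite ι
  exact hH b.toOrthonormalBasis.toBasis.finiteDimensional_of_finite

theorem exists_hilbertBasis_eigenvectors [CompleteSpace H] {T : H →L[𝕜] H}
    (hT : IsCompactOperator T) (hsymm : T.IsSymmetric) (hinj : ∀ x, T x = 0 → x = 0) :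
    ∃ (ι : Type u) (b : HilbertBasis ι 𝕜 H) (m : ι → 𝕜), ∀ i, T (b i) = m i • b i := by
  have hfin : ∀ μ : 𝕜, FiniteDimensional 𝕜 (Module.End.eigenspace T.toLinearMap μ) := by
    intro μ
    by_cases hμ : μ = 0
    · have hbot : Module.End.eigenspace T.toLinearMap μ = ⊥ := by
        rw [hμ, Module.End.eigenspace_zero, LinearMap.ker_eq_bot']
        exact hinj
      rw [hbot]
      infer_instance
    · exact ContinuousLinearMap.finite_dimensional_eigenspace hT μ hμ
  let e (μ : 𝕜) := stdOrthonormalBasis 𝕜 (Module.End.eigenspace T.toLinearMap μ)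
  have horth := hsymm.orthogonalFamily_eigenspaces.orthonormal_sigma_orthonormal
    (v_family := fun μ ↦ e μ) fun μ ↦ (e μ).orthonormal
  refine ⟨_, .mkOfOrthogonalEqBot horth ?_, fun i ↦ i.1, ?_⟩
  · rw [eq_bot_iff, ← ContinuousLinearMap.orthogonalComplement_iSup_eigenspaces_eq_bot hT hsymm]
    refine Submodule.orthogonal_le (iSup_le fun μ x hx ↦ ?_)
    have hsum := congrArg Subtype.val ((e μ).sum_repr ⟨x, hx⟩)
    rw [AddSubmonoidClass.coe_finsetSum] at hsum
    rw [← show _ = x from hsum]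
    exact Submodule.sum_mem _ fun i _ ↦
      Submodule.smul_mem _ _ (Submodule.subset_span ⟨⟨μ, i⟩, rfl⟩)
  · rintro ⟨μ, i⟩
    rw [HilbertBasis.coe_mkOfOrthogonalEqBot]
    exact Module.End.mem_eigenspace_iff.1 (e μ i).2

end CompactOperators

theorem exists_hilbertBasis_nat_inv_eigenvalues {H : Type*} [NormedAddCommGroup H]
    [InnerProductSpace ℝ H] [CompleteSpace H] (hH : ¬ FiniteDimensional ℝ H) {T : H →L[ℝ] H}
    (hT : IsCompactOperator T) (hsymm : T.IsSymmetric) (hpos : ∀ x ≠ 0, 0 < inner ℝ (T x) x) :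
    ∃ (b : HilbertBasis ℕ ℝ H) (l : ℕ → ℝ), (∀ j, 0 < l j) ∧ Monotone l ∧
      Filter.Tendsto l Filter.atTop Filter.atTop ∧ ∀ j, T (b j) = (l j)⁻¹ • b j := by
  have hinj : ∀ x, T x = 0 → x = 0 := fun x hx ↦ by
    by_contra hne
    simpa [hx] using hpos x hne
  obtain ⟨ι, b, m, hm⟩ := exists_hilbertBasis_eigenvectors hT hsymm hinj
  have hmpos : ∀ i, 0 < m i := fun i ↦ by
    simpa [hm, real_inner_smul_left, b.orthonormal.1] using hpos (b i) (b.orthonormal.ne_zero i)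
  have hsub : ∀ M : ℝ, {i | (m i)⁻¹ ≤ M}.Finite := by
    intro M
    rcases le_or_gt M 0 with hM | hM
    · convert Set.finite_empty
      exact Set.eq_empty_of_forall_notMem fun i hi ↦ (inv_pos.2 (hmpos i)).not_ge (hi.trans hM)
    · refine (finite_setOf_le_norm_eigenvalue hT b.orthonormal hm (inv_pos.2 hM)).subset
        fun i hi ↦ ?_
      exact (inv_le_of_inv_le₀ (hmpos i) hi).trans (Real.le_norm_self _)
  have := infinite_of_hilbertBasis b hH
  obtain ⟨e, he⟩ := exists_equiv_nat_monotone_of_finite_sublevel (fun i ↦ (m i)⁻¹) hsub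
  have hspan : (Submodule.span ℝ (Set.range (b ∘ e)))ᗮ = ⊥ := by
    rw [e.surjective.range_comp, ← Submodule.topologicalClosure_eq_top_iff, b.dense_span]
  refine ⟨.mkOfOrthogonalEqBot (b.orthonormal.comp e e.injective) hspan,
    fun j ↦ (m (e j))⁻¹, fun j ↦ inv_pos.2 (hmpos _), he, ?_, ?_⟩
  · rw [Filter.tendsto_atTop]
    intro M
    have hcofinite := ((hsub M).preimage e.injective.injOn).compl_mem_cofinite
    rw [Nat.cofinite_eq_atTop] at hcofinite
    filter_upwards [hcofinite] with j hj using le_of_not_ge hj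
  · intro j
    rw [HilbertBasis.coe_mkOfOrthogonalEqBot, inv_inv]
    exact hm _

/-! ### Quadratic forms -/

section Forms

variable {H G : Type*} [NormedAddCommGroup H] [InnerProductSpace ℝ H]
  [NormedAddCommGroup G] [InnerProductSpace ℝ G]

/-- Eigenvectors of the quadratic form `u ↦ ‖∇u‖²` on `H`, in the weak sense. The form is encoded by
the graph `V` of the operator `∇` on its domain, and an eigenvector by its point `(u, ∇u)` of the
graph, so that no functional calculus for unbounded operators is needed. -/
structure IsFormEigenvector (V : Submodule ℝ (H × G)) (ν : ℝ) (p : H × G) : Prop where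
  mem : p ∈ V
  inner_eq : ∀ q ∈ V, inner ℝ p.2 q.2 = ν * inner ℝ p.1 q.1

/-- An orthonormal basis of eigenvectors of the quadratic form with graph `V`, enumerated by
increasing eigenvalues. -/
structure FormEigenbasis (V : Submodule ℝ (H × G)) where
  basis : HilbertBasis ℕ ℝ H
  grad : ℕ → G
  eigenvalue : ℕ → ℝ
  monotone : Monotone eigenvalue
  tendsto_atTop : Filter.Tendsto eigenvalue Filter.atTop Filter.atTop
  isFormEigenvector : ∀ j, IsFormEigenvector V (eigenvalue j) (basis j, grad j)

variable {V : Submodule ℝ (H × G)}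

theorem IsFormEigenvector.norm_sq_snd {ν : ℝ} {p : H × G} (hp : IsFormEigenvector V ν p) :
    ‖p.2‖ ^ 2 = ν * ‖p.1‖ ^ 2 := by
  rw [← real_inner_self_eq_norm_sq, ← real_inner_self_eq_norm_sq, hp.inner_eq p hp.mem]

theorem FormEigenbasis.norm_grad_sq (B : FormEigenbasis V) (j : ℕ) :
    ‖B.grad j‖ ^ 2 = B.eigenvalue j := by
  rw [(B.isFormEigenvector j).norm_sq_snd, B.basis.orthonormal.norm_eq_one, one_pow, mul_one]

theorem IsFormEigenvector.inner_fst_eq_zero {ν ξ : ℝ} {p q : H × G}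
    (hp : IsFormEigenvector V ν p) (hq : IsFormEigenvector V ξ q) (hne : ν ≠ ξ) :
    inner ℝ p.1 q.1 = 0 := by
  have hcomm := hq.inner_eq p hp.mem
  rw [real_inner_comm p.2, real_inner_comm p.1, hp.inner_eq q hq.mem] at hcomm
  exact (mul_eq_mul_right_iff.1 hcomm).resolve_left hne

/-- The resolvent `(1 - Δ)⁻¹` of the form, together with its gradient, is the adjoint of the
inclusion of the form domain into `H`. -/
theorem exists_form_resolvent [CompleteSpace H] [CompleteSpace G]
    (hV : IsClosed (V : Set (H × G))) :
    ∃ (T : H →L[ℝ] H) (R : H →L[ℝ] G), ∀ x, (T x, R x) ∈ V ∧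
      ∀ p ∈ V, inner ℝ (T x) p.1 + inner ℝ (R x) p.2 = inner ℝ x p.1 := by
  let W : Submodule ℝ (WithLp 2 (H × G)) :=
    V.comap (WithLp.prodContinuousLinearEquiv 2 ℝ H G).toLinearMap
  have : CompleteSpace W :=
    (hV.preimage (WithLp.prodContinuousLinearEquiv 2 ℝ H G).continuous).completeSpace_coe
  let A : W →L[ℝ] H := WithLp.fstL 2 ℝ H G ∘L W.subtypeL
  let S : H →L[ℝ] WithLp 2 (H × G) := W.subtypeL ∘L ContinuousLinearMap.adjoint A
  exact ⟨WithLp.fstL 2 ℝ H G ∘L S, WithLp.sndL 2 ℝ H G ∘L S, fun x ↦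
    ⟨(ContinuousLinearMap.adjoint A x).2, fun p hp ↦
      ContinuousLinearMap.adjoint_inner_left A ⟨WithLp.toLp 2 p, hp⟩ x⟩⟩

theorem exists_compact_form_resolvent [CompleteSpace H] [CompleteSpace G]
    (hV : IsClosed (V : Set (H × G)))
    (hdense : ∀ x : H, (∀ p ∈ V, inner ℝ x p.1 = 0) → x = 0)
    (hsmall : ∀ ε > 0, ∃ s : Finset H, ∀ p ∈ V, (∀ e ∈ s, inner ℝ e p.1 = 0) →
      ‖p.1‖ ≤ ε * ‖p.2‖) :
    ∃ (T : H →L[ℝ] H) (R : H →L[ℝ] G), (∀ x, (T x, R x) ∈ V ∧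
      ∀ p ∈ V, inner ℝ (T x) p.1 + inner ℝ (R x) p.2 = inner ℝ x p.1) ∧
      IsCompactOperator T ∧ T.IsSymmetric ∧ ∀ x ≠ 0, 0 < inner ℝ (T x) x := by
  obtain ⟨T, R, hTR⟩ := exists_form_resolvent hV
  have hinner : ∀ x y, inner ℝ x (T y) = inner ℝ (T x) (T y) + inner ℝ (R x) (R y) :=
    fun x y ↦ ((hTR x).2 _ (hTR y).1).symm
  have hsymm : T.IsSymmetric := fun x y ↦ by
    change inner ℝ (T x) y = inner ℝ x (T y)
    rw [hinner x, real_inner_comm, hinner y, real_inner_comm, real_inner_comm (R x)]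
  have hself : ∀ x, inner ℝ x (T x) = ‖T x‖ ^ 2 + ‖R x‖ ^ 2 := fun x ↦ by
    rw [hinner, real_inner_self_eq_norm_sq, real_inner_self_eq_norm_sq]
  have hR : ∀ x, ‖R x‖ ≤ ‖x‖ := fun x ↦ by
    refine le_of_sq_le_sq ?_ (norm_nonneg x)
    nlinarith [hself x, real_inner_le_norm x (T x), sq_nonneg (‖T x‖ - ‖x‖),
      sq_nonneg ‖T x‖, sq_nonneg ‖x‖]
  refine ⟨T, R, hTR, isCompactOperator_of_small_on_finite_codim T fun ε hε ↦ ?_, hsymm,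
    fun x hx ↦ ?_⟩
  · obtain ⟨s, hs⟩ := hsmall ε hε
    refine ⟨s, fun x hx ↦ (hs _ (hTR x).1 hx).trans ?_⟩
    gcongr
    exact hR x
  · rw [real_inner_comm, hself]
    by_contra! hle
    have hTx : T x = 0 := by
      rw [← norm_eq_zero, ← sq_eq_zero_iff]; nlinarith [sq_nonneg ‖T x‖, sq_nonneg ‖R x‖]
    have hRx : R x = 0 := by
      rw [← norm_eq_zero, ← sq_eq_zero_iff]; nlinarith [sq_nonneg ‖T x‖, sq_nonneg ‖R x‖]
    exact hx (hdense x fun p hp ↦ by simp [← (hTR x).2 p hp, hTx, hRx])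

theorem FormEigenbasis.nonempty_of_small_on_finite_codim [CompleteSpace H] [CompleteSpace G]
    (hH : ¬ FiniteDimensional ℝ H) (hV : IsClosed (V : Set (H × G)))
    (hdense : ∀ x : H, (∀ p ∈ V, inner ℝ x p.1 = 0) → x = 0)
    (hsmall : ∀ ε > 0, ∃ s : Finset H, ∀ p ∈ V, (∀ e ∈ s, inner ℝ e p.1 = 0) →
      ‖p.1‖ ≤ ε * ‖p.2‖) :
    Nonempty (FormEigenbasis V) := by
  obtain ⟨T, R, hTR, hT, hsymm, hpos⟩ := exists_compact_form_resolvent hV hdense hsmall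
  obtain ⟨b, l, hl, hmono, htop, hb⟩ := exists_hilbertBasis_nat_inv_eigenvalues hH hT hsymm hpos
  have hbl : ∀ j, l j • T (b j) = b j := fun j ↦ by rw [hb, smul_inv_smul₀ (hl j).ne']
  refine ⟨⟨b, fun j ↦ l j • R (b j), fun j ↦ l j - 1, fun i j hij ↦ by simpa using hmono hij,
    Filter.tendsto_atTop_add_const_right _ _ htop, fun j ↦ ⟨?_, fun q hq ↦ ?_⟩⟩⟩
  · simpa [hbl] using V.smul_mem (l j) (hTR (b j)).1
  · have hres := congrArg (l j * ·) ((hTR (b j)).2 q hq)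
    rw [mul_add, ← real_inner_smul_left, ← real_inner_smul_left, hbl] at hres
    change inner ℝ (l j • R (b j)) q.2 = (l j - 1) * inner ℝ (b j) q.1
    linarith

end Forms

/-! ### The Dirichlet eigenbasis -/

theorem enorm_sq_eq_lintegral_of_ae_eq {α F : Type*} [MeasurableSpace α] {μ : Measure α}
    [NormedAddCommGroup F] {u : Lp F 2 μ} {f : α → F} (h : u =ᵐ[μ] f) :
    ‖u‖ₑ ^ 2 = ∫⁻ x, ‖f x‖ₑ ^ 2 ∂μ := by
  rw [Lp.enorm_def, eLpNorm_congr_ae h, eLpNorm_two_sq_eq_lintegral]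

theorem inner_eq_integral_inner_of_ae_eq {α F : Type*} [MeasurableSpace α] {μ : Measure α}
    [NormedAddCommGroup F] [InnerProductSpace ℝ F] (u : Lp F 2 μ) {v : Lp F 2 μ} {f : α → F}
    (h : v =ᵐ[μ] f) : inner ℝ u v = ∫ x, inner ℝ (u x) (f x) ∂μ := by
  rw [L2.inner_def]
  refine integral_congr_ae ?_
  filter_upwards [h] with x hx
  rw [hx]

theorem not_finiteDimensional_Lp_two {α : Type*} [MeasurableSpace α] {μ : Measure α}
    {S : ℕ → Set α} (hS : ∀ k, MeasurableSet (S k)) (h0 : ∀ k, μ (S k) ≠ 0)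
    (htop : ∀ k, μ (S k) ≠ ⊤) (hdisj : Pairwise (Function.onFun Disjoint S)) :
    ¬ FiniteDimensional ℝ (Lp ℝ 2 μ) := by
  intro hfd
  let f (k : ℕ) : Lp ℝ 2 μ := indicatorConstLp 2 (hS k) (htop k) 1
  have hinner : ∀ i j, inner ℝ (f i) (f j) = μ.real (S i ∩ S j) := fun i j ↦
    L2.real_inner_indicatorConstLp_one_indicatorConstLp_one (hS i) (hS j) (htop i) (htop j)
  have hf : LinearIndependent ℝ f := by
    refine linearIndependent_of_ne_zero_of_inner_eq_zero (𝕜 := ℝ) (fun k hk ↦ ?_) fun i j hij ↦ ?_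
    · have hself := hinner k k
      rw [hk, inner_zero_left, Set.inter_self, eq_comm, measureReal_eq_zero_iff (htop k)] at hself
      exact h0 k hself
    · exact (hinner i j).trans (by rw [(hdisj hij).inter_eq, measureReal_empty])
  have := hf.finite
  exact not_finite ℕ

section Domain

variable {n : ℕ} {Ω : Set (EuclideanSpace ℝ (Fin n))}

namespace IsTestFunction

variable {φ : EuclideanSpace ℝ (Fin n) → ℝ}

theorem eq_zero_of_notMem (hφ : IsTestFunction Ω φ) {x : EuclideanSpace ℝ (Fin n)} (hx : x ∉ Ω) :
    φ x = 0 :=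
  image_eq_zero_of_notMem_tsupport fun h ↦ hx (hφ.tsupport_subset h)

theorem fderiv_eq_zero_of_notMem (hφ : IsTestFunction Ω φ) {x : EuclideanSpace ℝ (Fin n)}
    (hx : x ∉ Ω) : fderiv ℝ φ x = 0 :=
  image_eq_zero_of_notMem_tsupport fun h ↦ hx (hφ.tsupport_subset (tsupport_fderiv_subset ℝ h))

theorem toLp_mem_sobolevGraph (hφ : IsTestFunction Ω φ) :
    (hφ.memLp.toLp, hφ.memLp_gradient.toLp) ∈ sobolevGraph Ω :=
  (testGraph Ω).le_topologicalClosure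
    ⟨φ, hφ, hφ.memLp.coeFn_toLp, hφ.memLp_gradient.coeFn_toLp⟩

theorem setLIntegral_enorm_gradient_sq (hφ : IsTestFunction Ω φ) :
    ∫⁻ x in Ω, ‖gradient φ x‖ₑ ^ 2 = ∫⁻ x, ‖fderiv ℝ φ x‖ₑ ^ 2 := by
  have hnorm : ∀ x, ‖gradient φ x‖ₑ = ‖fderiv ℝ φ x‖ₑ := fun x ↦
    (InnerProductSpace.toDual ℝ (EuclideanSpace ℝ (Fin n))).symm.enorm_map _
  simp_rw [hnorm]
  refine setLIntegral_eq_of_support_subset fun x hx ↦ ?_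
  by_contra hxΩ
  exact hx (by simp [hφ.fderiv_eq_zero_of_notMem hxΩ, ← ofReal_norm])

end IsTestFunction

theorem restrict_ball_ne_top (Ω : Set (EuclideanSpace ℝ (Fin n))) (c : EuclideanSpace ℝ (Fin n))
    (δ : ℝ) : (volume.restrict Ω) (Metric.ball c δ) ≠ ⊤ :=
  ((Measure.restrict_apply_le _ _).trans_lt measure_ball_lt_top).ne

/-- The element of `L²(Ω)` whose inner product with a function extended by zero outside `Ω` is the
average of that function over a ball; orthogonality to finitely many of these is the finite
codimension in Rellich's theorem. -/
noncomputable def ballMean (Ω : Set (EuclideanSpace ℝ (Fin n))) (c : EuclideanSpace ℝ (Fin n))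
    (δ : ℝ) : L2Scalar Ω :=
  indicatorConstLp 2 Metric.isOpen_ball.measurableSet (restrict_ball_ne_top Ω c δ)
    (volume.real (Metric.ball c δ))⁻¹

theorem inner_ballMean (hΩ : MeasurableSet Ω) {φ : EuclideanSpace ℝ (Fin n) → ℝ}
    (hφ : IsTestFunction Ω φ) {u : L2Scalar Ω} (hu : u =ᵐ[volume.restrict Ω] φ)
    (c : EuclideanSpace ℝ (Fin n)) (δ : ℝ) :
    inner ℝ (ballMean Ω c δ) u = ⨍ y in Metric.ball c δ, φ y := by
  have hint : ∫ x in Metric.ball c δ, u x ∂volume.restrict Ω = ∫ x in Metric.ball c δ, φ x := by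
    rw [integral_congr_ae (ae_restrict_of_ae hu),
      Measure.restrict_restrict Metric.isOpen_ball.measurableSet, Set.inter_comm,
      ← Measure.restrict_restrict hΩ]
    exact setIntegral_eq_integral_of_forall_compl_eq_zero fun x hx ↦ hφ.eq_zero_of_notMem hx
  rw [ballMean, L2.inner_indicatorConstLp_eq_inner_setIntegral, hint, setAverage_eq, smul_eq_mul]
  simp [mul_comm]

theorem enorm_sq_le_of_mem_testGraph (hΩ : MeasurableSet Ω) {δ : ℝ} (hδ : 0 < δ)
    {s : Finset (EuclideanSpace ℝ (Fin n))} (hs : Ω ⊆ ⋃ c ∈ s, Metric.ball c δ)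
    {p : L2Scalar Ω × L2Vector Ω} (hp : p ∈ testGraph Ω) :
    ‖p.1‖ₑ ^ 2 ≤ 2 ^ (n + 1) * ENNReal.ofReal (2 * δ) ^ 2 * ‖p.2‖ₑ ^ 2 +
      2 * volume Ω * ∑ c ∈ s, ‖(inner ℝ (ballMean Ω c δ) p.1 : ℝ)‖ₑ ^ 2 := by
  obtain ⟨φ, hφ, hu, hg⟩ := hp
  simp_rw [inner_ballMean hΩ hφ hu]
  rw [enorm_sq_eq_lintegral_of_ae_eq hu, enorm_sq_eq_lintegral_of_ae_eq hg,
    hφ.setLIntegral_enorm_gradient_sq]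
  simpa using lintegral_enorm_sq_le_of_ball_cover volume
    (hφ.contDiff.of_le (by exact_mod_cast le_top)) hδ hΩ hs

theorem enorm_sq_le_of_mem_sobolevGraph (hΩ : MeasurableSet Ω) (hvol : volume Ω ≠ ⊤) {δ : ℝ}
    (hδ : 0 < δ) {s : Finset (EuclideanSpace ℝ (Fin n))} (hs : Ω ⊆ ⋃ c ∈ s, Metric.ball c δ)
    {p : L2Scalar Ω × L2Vector Ω} (hp : p ∈ sobolevGraph Ω) :
    ‖p.1‖ₑ ^ 2 ≤ 2 ^ (n + 1) * ENNReal.ofReal (2 * δ) ^ 2 * ‖p.2‖ₑ ^ 2 +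
      2 * volume Ω * ∑ c ∈ s, ‖(inner ℝ (ballMean Ω c δ) p.1 : ℝ)‖ₑ ^ 2 := by
  refine closure_minimal (fun q hq ↦ enorm_sq_le_of_mem_testGraph hΩ hδ hs hq)
    (isClosed_le (ENNReal.continuous_pow 2 |>.comp continuous_fst.enorm) (.fun_add ?_ ?_)) hp
  · exact (ENNReal.continuous_const_mul (by finiteness)).comp (by fun_prop)
  · exact (ENNReal.continuous_const_mul (by finiteness)).comp (by fun_prop)

/-- Rellich's theorem: by `isCompactOperator_of_small_on_finite_codim` this is the compactness of
the embedding of `H¹₀(Ω)` into `L²(Ω)`. -/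
theorem sobolevGraph_small_on_finite_codim (hΩ : IsOpen Ω) (hb : Bornology.IsBounded Ω) {ε : ℝ}
    (hε : 0 < ε) : ∃ s : Finset (L2Scalar Ω), ∀ p ∈ sobolevGraph Ω,
      (∀ e ∈ s, inner ℝ e p.1 = 0) → ‖p.1‖ ≤ ε * ‖p.2‖ := by
  classical
  set δ : ℝ := ε / 2 ^ (n + 1) / 2 with hδdef
  have hδ : 0 < δ := by positivity
  obtain ⟨t, -, ht, hcover⟩ := Metric.finite_approx_of_totallyBounded
    (hb.isCompact_closure.totallyBounded.subset subset_closure) δ hδ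
  refine ⟨ht.toFinset.image fun c ↦ ballMean Ω c δ, fun p hp horth ↦ ?_⟩
  have hle := enorm_sq_le_of_mem_sobolevGraph hΩ.measurableSet hb.measure_lt_top.ne hδ
    (s := ht.toFinset) (by simpa using hcover) hp
  rw [Finset.sum_eq_zero fun c hc ↦ by simp [horth _ (Finset.mem_image_of_mem _ hc)], mul_zero,
    add_zero] at hle
  have hconst : (2 : ENNReal) ^ (n + 1) * ENNReal.ofReal (2 * δ) ^ 2 ≤ ENNReal.ofReal ε ^ 2 := by
    rw [← ENNReal.ofReal_ofNat, ← ENNReal.ofReal_pow zero_le_two,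
      ← ENNReal.ofReal_pow (by positivity), ← ENNReal.ofReal_pow hε.le,
      ← ENNReal.ofReal_mul (by positivity)]
    refine ENNReal.ofReal_le_ofReal ?_
    calc (2 : ℝ) ^ (n + 1) * (2 * δ) ^ 2 = ε ^ 2 / 2 ^ (n + 1) := by rw [hδdef]; field_simp
      _ ≤ ε ^ 2 := div_le_self (sq_nonneg ε) (one_le_pow₀ one_le_two)
  have hsq : ‖p.1‖ₑ ^ 2 ≤ (ENNReal.ofReal ε * ‖p.2‖ₑ) ^ 2 := by
    rw [mul_pow]
    exact hle.trans (mul_le_mul_left hconst _)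
  have h := (ENNReal.pow_le_pow_left_iff two_ne_zero).1 hsq
  rwa [← ofReal_norm, ← ofReal_norm, ← ENNReal.ofReal_mul hε.le,
    ENNReal.ofReal_le_ofReal_iff (by positivity)] at h

theorem eq_zero_of_inner_sobolevGraph_eq_zero (hΩ : IsOpen Ω) (u : L2Scalar Ω)
    (hu : ∀ p ∈ sobolevGraph Ω, inner ℝ u p.1 = 0) : u = 0 := by
  have hloc : LocallyIntegrableOn u Ω := by
    have h := (Lp.memLp u).locallyIntegrable one_le_two
    exact locallyIntegrableOn_of_locallyIntegrable_restrict h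
  have hae : ∀ᵐ x, x ∈ Ω → u x = 0 := by
    refine hΩ.ae_eq_zero_of_integral_contDiff_smul_eq_zero hloc fun φ hsmooth hsupp hsub ↦ ?_
    have hφ : IsTestFunction Ω φ := ⟨hsmooth, hsupp, hsub⟩
    rw [← setIntegral_eq_integral_of_forall_compl_eq_zero
      fun x hx ↦ by simp [hφ.eq_zero_of_notMem hx], ← hu _ hφ.toLp_mem_sobolevGraph,
      inner_eq_integral_inner_of_ae_eq u hφ.memLp.coeFn_toLp]
    rfl
  rw [Lp.eq_zero_iff_ae_eq_zero, Filter.EventuallyEq, ae_restrict_iff' hΩ.measurableSet]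
  exact hae

theorem not_finiteDimensional_L2Scalar [NeZero n] (hΩ : IsOpen Ω) (hne : Ω.Nonempty)
    (hvol : volume Ω ≠ ⊤) : ¬ FiniteDimensional ℝ (L2Scalar Ω) := by
  obtain ⟨x, hx⟩ := hne
  have : Infinite Ω := (infinite_of_mem_nhds x (hΩ.mem_nhds hx)).to_subtype
  obtain ⟨U, hUinf, hUo, hUd⟩ := exists_seq_infinite_isOpen_pairwise_disjoint Ω
  have hUo' : ∀ k, IsOpen (Subtype.val '' U k) := fun k ↦ hΩ.isOpenMap_subtype_val _ (hUo k)
  have hvolU : ∀ k, (volume.restrict Ω) (Subtype.val '' U k) = volume (Subtype.val '' U k) :=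
    fun k ↦ by
      rw [Measure.restrict_apply (hUo' k).measurableSet,
        Set.inter_eq_left.2 (Subtype.coe_image_subset Ω (U k))]
  refine not_finiteDimensional_Lp_two (fun k ↦ (hUo' k).measurableSet) (fun k ↦ ?_) (fun k ↦ ?_)
    fun i j hij ↦ (Set.disjoint_image_iff Subtype.val_injective).2 (hUd hij)
  · rw [hvolU]
    exact ((hUo' k).measure_pos volume ((hUinf k).nonempty.image _)).ne'
  · rw [hvolU]
    exact measure_ne_top_of_subset (Subtype.coe_image_subset Ω (U k)) hvol

theorem nonempty_formEigenbasis_sobolevGraph [NeZero n] (hΩ : IsOpen Ω) (hne : Ω.Nonempty)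
    (hb : Bornology.IsBounded Ω) : Nonempty (FormEigenbasis (sobolevGraph Ω)) :=
  FormEigenbasis.nonempty_of_small_on_finite_codim
    (not_finiteDimensional_L2Scalar hΩ hne hb.measure_lt_top.ne)
    (Submodule.isClosed_topologicalClosure _) (eq_zero_of_inner_sobolevGraph_eq_zero hΩ)
    fun _ hε ↦ sobolevGraph_small_on_finite_codim hΩ hb hε

end Domain

theorem natCast_succ_le_mk_sublevel_iff {l : ℕ → ℝ} (hl : Monotone l) {k : ℕ} {μ : ℝ} :
    ((k + 1 : ℕ) : Cardinal) ≤ Cardinal.mk {j | l j ≤ μ} ↔ l k ≤ μ := by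
  have hmk : ∀ m : ℕ, Cardinal.mk (Finset.range m : Set ℕ) = m := fun m ↦ by simp
  constructor
  · intro h
    by_contra! hlt
    have hsub : {j | l j ≤ μ} ⊆ (Finset.range k : Set ℕ) := fun j hj ↦ by
      rw [Finset.coe_range, Set.mem_Iio]
      by_contra! hkj
      exact (hlt.trans_le (hl hkj)).not_ge hj
    have hcard := h.trans (Cardinal.mk_le_mk_of_subset hsub)
    rw [hmk, Nat.cast_le] at hcard
    omega
  · intro h
    have hsub : (Finset.range (k + 1) : Set ℕ) ⊆ {j | l j ≤ μ} := fun j hj ↦ by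
      rw [Finset.coe_range, Set.mem_Iio] at hj
      exact (hl (Nat.lt_succ_iff.1 hj)).trans h
    have hcard := Cardinal.mk_le_mk_of_subset hsub
    rwa [hmk] at hcard

section Eigenvalues

variable {n : ℕ} {Ω : Set (EuclideanSpace ℝ (Fin n))}

theorem mem_dirichletEigenspace_iff {ν : ℝ} {u : L2Scalar Ω} :
    u ∈ dirichletEigenspace Ω ν ↔ ∃ g, IsFormEigenvector (sobolevGraph Ω) ν (u, g) := by
  have hweak : ∀ (g : L2Vector Ω) {φ : EuclideanSpace ℝ (Fin n) → ℝ} {v : L2Scalar Ω}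
      {h : L2Vector Ω}, v =ᵐ[volume.restrict Ω] φ → h =ᵐ[volume.restrict Ω] gradient φ →
      (inner ℝ g h = ν * inner ℝ u v ↔
        ∫ x in Ω, inner ℝ (g x) (gradient φ x) = ν * ∫ x in Ω, u x * φ x) :=
    fun g φ v h hv hh ↦ by
      rw [inner_eq_integral_inner_of_ae_eq g hh, inner_eq_integral_inner_of_ae_eq u hv]
      simp only [RCLike.inner_apply', conj_trivial]
  constructor
  · rintro ⟨g, hg, h⟩
    refine ⟨g, hg, fun p hp ↦ ?_⟩
    have hclosed : IsClosed {p : L2Scalar Ω × L2Vector Ω | inner ℝ g p.2 = ν * inner ℝ u p.1} :=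
      isClosed_eq (by fun_prop) (by fun_prop)
    refine closure_minimal (fun q hq ↦ ?_) hclosed hp
    obtain ⟨φ, hφ, hu, hgrad⟩ := hq
    exact (hweak g hu hgrad).2 (h φ hφ)
  · rintro ⟨g, hg, h⟩
    exact ⟨g, hg, fun φ hφ ↦ (hweak g hφ.memLp.coeFn_toLp hφ.memLp_gradient.coeFn_toLp).1
      (h _ hφ.toLp_mem_sobolevGraph)⟩

namespace FormEigenbasis

variable (B : FormEigenbasis (sobolevGraph Ω))

theorem iSup_dirichletEigenspace_eq_span (μ : ℝ) :
    ⨆ ν : ℝ, ⨆ _ : ν ≤ μ, dirichletEigenspace Ω ν =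
      Submodule.span ℝ (B.basis '' {j | B.eigenvalue j ≤ μ}) := by
  apply le_antisymm
  · refine iSup₂_le fun ν hν u hu ↦ ?_
    obtain ⟨g, hg⟩ := mem_dirichletEigenspace_iff.1 hu
    have hfin : {j | B.eigenvalue j ≤ μ}.Finite := by
      have := B.tendsto_atTop.eventually_gt_atTop μ
      rw [← Nat.cofinite_eq_atTop] at this
      exact this.subset fun j hj h ↦ not_lt.2 (show B.eigenvalue j ≤ μ from hj) h
    have hsum : HasSum (fun j ↦ B.basis.repr u j • B.basis j)
        (∑ j ∈ hfin.toFinset, B.basis.repr u j • B.basis j) := by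
      refine hasSum_sum_of_ne_finset_zero fun j hj ↦ ?_
      rw [Set.Finite.mem_toFinset, Set.mem_ofPred, not_le] at hj
      have horth : inner ℝ (B.basis j) u = 0 :=
        (B.isFormEigenvector j).inner_fst_eq_zero hg (hν.trans_lt hj).ne'
      rw [B.basis.repr_apply_apply, horth, zero_smul]
    rw [(B.basis.hasSum_repr u).unique hsum]
    exact Submodule.sum_mem _ fun j hj ↦ Submodule.smul_mem _ _
      (Submodule.subset_span (Set.mem_image_of_mem B.basis (hfin.mem_toFinset.1 hj)))
  · rw [Submodule.span_le]
    rintro _ ⟨j, hj, rfl⟩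
    exact Submodule.mem_iSup_of_mem (B.eigenvalue j) (Submodule.mem_iSup_of_mem hj
      (mem_dirichletEigenspace_iff.2 ⟨B.grad j, B.isFormEigenvector j⟩))

theorem dirichletEigenvalue_succ (k : ℕ) : dirichletEigenvalue Ω (k + 1) = B.eigenvalue k := by
  have hset : {μ : ℝ | ((k + 1 : ℕ) : Cardinal) ≤
      Module.rank ℝ ↥(⨆ ν : ℝ, ⨆ _ : ν ≤ μ, dirichletEigenspace Ω ν)} =
        Set.Ici (B.eigenvalue k) := by
    ext μ
    have hli : LinearIndepOn ℝ id (B.basis '' {j | B.eigenvalue j ≤ μ}) :=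
      (B.basis.orthonormal.linearIndependent.linearIndepOn _).id_image
    rw [Set.mem_ofPred, Set.mem_Ici, B.iSup_dirichletEigenspace_eq_span, rank_span_set hli,
      Cardinal.mk_image_eq B.basis.orthonormal.linearIndependent.injective,
      natCast_succ_le_mk_sublevel_iff B.monotone]
  rw [dirichletEigenvalue, hset, csInf_Ici]

end FormEigenbasis

end Eigenvalues

/-! ### Multiplication by functions of a coordinate -/

section Multiplication

variable {α E : Type*} [MeasurableSpace α] {μ : Measure α} [NormedAddCommGroup E]

section NormedSpace

variable [NormedSpace ℝ E]

/-- The operator `u ↦ a u` on `L²(μ; E)`, for `a ∈ L^∞(μ)`. -/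
noncomputable def mulLp {a : α → ℝ} (ha : MemLp a ⊤ μ) : Lp E 2 μ →L[ℝ] Lp E 2 μ :=
  (ContinuousLinearMap.lsmul ℝ ℝ : ℝ →L[ℝ] E →L[ℝ] E).holderL μ ⊤ 2 2 ha.toLp

theorem coeFn_mulLp {a : α → ℝ} (ha : MemLp a ⊤ μ) (u : Lp E 2 μ) :
    mulLp ha u =ᵐ[μ] fun x ↦ a x • u x := by
  filter_upwards [(ContinuousLinearMap.lsmul ℝ ℝ : ℝ →L[ℝ] E →L[ℝ] E).coeFn_holder (r := 2)
    ha.toLp u, ha.coeFn_toLp] with x hmul hcoe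
  rw [mulLp, ContinuousLinearMap.holderL_apply_apply, hmul, hcoe, ContinuousLinearMap.lsmul_apply]

theorem mulLp_comm {a c : α → ℝ} (ha : MemLp a ⊤ μ) (hc : MemLp c ⊤ μ) (u : Lp E 2 μ) :
    mulLp ha (mulLp hc u) = mulLp hc (mulLp ha u) := by
  apply Lp.ext
  filter_upwards [coeFn_mulLp ha (mulLp hc u), coeFn_mulLp hc u, coeFn_mulLp hc (mulLp ha u),
    coeFn_mulLp ha u] with x hac hcu hca hau
  rw [hac, hcu, hca, hau, smul_comm]

theorem mulLp_eq_smul {a : α → ℝ} {r : ℝ} (ha : MemLp a ⊤ μ) (h : ∀ x, a x = r) (u : Lp E 2 μ) :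
    mulLp ha u = r • u := by
  apply Lp.ext
  filter_upwards [coeFn_mulLp ha u, Lp.coeFn_smul r u] with x hau hr
  rw [hau, hr, Pi.smul_apply, h]

end NormedSpace

variable [InnerProductSpace ℝ E]

theorem inner_mulLp_left {a : α → ℝ} (ha : MemLp a ⊤ μ) (u v : Lp E 2 μ) :
    inner ℝ (mulLp ha u) v = inner ℝ u (mulLp ha v) := by
  rw [L2.inner_def, L2.inner_def]
  refine integral_congr_ae ?_
  filter_upwards [coeFn_mulLp ha u, coeFn_mulLp ha v] with x hu hv
  rw [hu, hv, real_inner_smul_left, real_inner_smul_right]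

theorem norm_mulLp_sq_add_norm_mulLp_sq {a c : α → ℝ} (ha : MemLp a ⊤ μ) (hc : MemLp c ⊤ μ)
    (h : ∀ x, a x ^ 2 + c x ^ 2 = 1) (u : Lp E 2 μ) :
    ‖mulLp ha u‖ ^ 2 + ‖mulLp hc u‖ ^ 2 = ‖u‖ ^ 2 := by
  simp_rw [← real_inner_self_eq_norm_sq, L2.inner_def]
  rw [← integral_add (L2.integrable_inner (𝕜 := ℝ) _ _) (L2.integrable_inner (𝕜 := ℝ) _ _)]
  refine integral_congr_ae ?_
  filter_upwards [coeFn_mulLp ha u, coeFn_mulLp hc u] with x hau hcu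
  rw [hau, hcu, real_inner_smul_left, real_inner_smul_right, real_inner_smul_left,
    real_inner_smul_right]
  linear_combination inner ℝ (u x) (u x) * h x

end Multiplication

section Coordinates

variable {n : ℕ} {Ω : Set (EuclideanSpace ℝ (Fin n))}

theorem memLp_top_restrict_of_continuous {X : Type*} [PseudoMetricSpace X] [ProperSpace X]
    [MeasurableSpace X] [OpensMeasurableSpace X] {μ : Measure X}
    {s : Set X} (hs : Bornology.IsBounded s) {f : X → ℝ} (hf : Continuous f) :
    MemLp f ⊤ (μ.restrict s) := by
  obtain ⟨C, hC⟩ := hs.isCompact_closure.exists_bound_of_continuousOn hf.continuousOn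
  refine memLp_top_of_bound hf.aestronglyMeasurable C ?_
  refine ae_restrict_of_ae_restrict_of_subset subset_closure ?_
  exact (ae_restrict_iff' isClosed_closure.measurableSet).2 (.of_forall hC)

/-- Multiplication by `F (x p)` on `L²(Ω; E)`. -/
noncomputable def coordMul {E : Type*} [NormedAddCommGroup E] [NormedSpace ℝ E]
    (hb : Bornology.IsBounded Ω) (p : Fin n) {F : ℝ → ℝ} (hF : ContDiff ℝ (⊤ : ℕ∞) F) :
    Lp E 2 (volume.restrict Ω) →L[ℝ] Lp E 2 (volume.restrict Ω) :=
  mulLp (a := fun x : EuclideanSpace ℝ (Fin n) ↦ F (x p))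
    (memLp_top_restrict_of_continuous hb (hF.continuous.comp (by fun_prop)))

theorem coeFn_coordMul {E : Type*} [NormedAddCommGroup E] [NormedSpace ℝ E]
    (hb : Bornology.IsBounded Ω) (p : Fin n) {F : ℝ → ℝ} (hF : ContDiff ℝ (⊤ : ℕ∞) F)
    (u : Lp E 2 (volume.restrict Ω)) :
    coordMul hb p hF u =ᵐ[volume.restrict Ω] fun x ↦ F (x p) • u x :=
  coeFn_mulLp _ u

theorem coordMul_eq_smul_coordMul {E : Type*} [NormedAddCommGroup E] [NormedSpace ℝ E]
    (hb : Bornology.IsBounded Ω) (p : Fin n) {F K : ℝ → ℝ} (hF : ContDiff ℝ (⊤ : ℕ∞) F)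
    (hK : ContDiff ℝ (⊤ : ℕ∞) K) {r : ℝ} (h : ∀ t, F t = r * K t)
    (u : Lp E 2 (volume.restrict Ω)) : coordMul hb p hF u = r • coordMul hb p hK u := by
  apply Lp.ext
  filter_upwards [coeFn_coordMul hb p hF u, coeFn_coordMul hb p hK u,
    Lp.coeFn_smul r (coordMul hb p hK u)] with x hFu hKu hr
  rw [hFu, hr, Pi.smul_apply, hKu, smul_smul, h]

theorem inner_coordMul_left {E : Type*} [NormedAddCommGroup E] [InnerProductSpace ℝ E]
    (hb : Bornology.IsBounded Ω) (p : Fin n) {F : ℝ → ℝ} (hF : ContDiff ℝ (⊤ : ℕ∞) F)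
    (u v : Lp E 2 (volume.restrict Ω)) :
    inner ℝ (coordMul hb p hF u) v = inner ℝ u (coordMul hb p hF v) :=
  inner_mulLp_left _ u v

/-- The operator `g ↦ g p` taking a vector field to its `p`-th component. -/
noncomputable def componentL (Ω : Set (EuclideanSpace ℝ (Fin n))) (p : Fin n) :
    L2Vector Ω →L[ℝ] L2Scalar Ω :=
  (EuclideanSpace.proj p : EuclideanSpace ℝ (Fin n) →L[ℝ] ℝ).compLpL 2 (volume.restrict Ω)

/-- The operator taking `u` to the vector field `u e_p`, the adjoint of `componentL Ω p`. -/
noncomputable def axisL (Ω : Set (EuclideanSpace ℝ (Fin n))) (p : Fin n) :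
    L2Scalar Ω →L[ℝ] L2Vector Ω :=
  (ContinuousLinearMap.toSpanSingleton ℝ (EuclideanSpace.single p (1 : ℝ))).compLpL 2
    (volume.restrict Ω)

theorem coeFn_componentL (p : Fin n) (g : L2Vector Ω) :
    componentL Ω p g =ᵐ[volume.restrict Ω] fun x ↦ g x p :=
  ContinuousLinearMap.coeFn_compLpL _ g

theorem coeFn_axisL (p : Fin n) (u : L2Scalar Ω) :
    axisL Ω p u =ᵐ[volume.restrict Ω] fun x ↦ u x • EuclideanSpace.single p (1 : ℝ) :=
  ContinuousLinearMap.coeFn_compLpL _ u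

theorem componentL_axisL (p : Fin n) (u : L2Scalar Ω) : componentL Ω p (axisL Ω p u) = u := by
  apply Lp.ext
  filter_upwards [coeFn_componentL p (axisL Ω p u), coeFn_axisL p u] with x hcomp haxis
  rw [hcomp, haxis]
  simp

theorem inner_axisL (p : Fin n) (g : L2Vector Ω) (u : L2Scalar Ω) :
    inner ℝ g (axisL Ω p u) = inner ℝ (componentL Ω p g) u := by
  rw [inner_eq_integral_inner_of_ae_eq g (coeFn_axisL p u), real_inner_comm,
    inner_eq_integral_inner_of_ae_eq u (coeFn_componentL p g)]
  simp [real_inner_smul_right, EuclideanSpace.inner_single_right, mul_comm]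

theorem componentL_coordMul (hb : Bornology.IsBounded Ω) (p q : Fin n) {F : ℝ → ℝ}
    (hF : ContDiff ℝ (⊤ : ℕ∞) F) (g : L2Vector Ω) :
    componentL Ω q (coordMul hb p hF g) = coordMul hb p hF (componentL Ω q g) := by
  apply Lp.ext
  filter_upwards [coeFn_componentL q (coordMul hb p hF g), coeFn_coordMul hb p hF g,
    coeFn_coordMul hb p hF (componentL Ω q g), coeFn_componentL q g] with x hcomp hmul hmulcomp hg
  rw [hcomp, hmul, hmulcomp, hg]
  simp

theorem sum_norm_componentL_sq (g : L2Vector Ω) : ∑ p, ‖componentL Ω p g‖ ^ 2 = ‖g‖ ^ 2 := by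
  simp_rw [← real_inner_self_eq_norm_sq, L2.inner_def]
  rw [← integral_finsetSum _ fun p _ ↦ L2.integrable_inner (𝕜 := ℝ) _ _]
  refine integral_congr_ae ?_
  filter_upwards [ae_all_iff.2 fun p ↦ coeFn_componentL p g] with x hx
  simp only [hx, real_inner_self_eq_norm_sq, EuclideanSpace.norm_sq_eq]

end Coordinates

/-! ### Products and integration by parts in `H¹₀(Ω)` -/

section Sobolev

variable {n : ℕ} {Ω : Set (EuclideanSpace ℝ (Fin n))}

theorem gradient_apply_coord (φ : EuclideanSpace ℝ (Fin n) → ℝ) (x : EuclideanSpace ℝ (Fin n))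
    (p : Fin n) : gradient φ x p = fderiv ℝ φ x (EuclideanSpace.single p 1) := by
  rw [← inner_gradient_left, EuclideanSpace.inner_single_right]
  simp

namespace IsTestFunction

variable {φ ψ : EuclideanSpace ℝ (Fin n) → ℝ}

theorem coord_mul (hφ : IsTestFunction Ω φ) (p : Fin n) {F : ℝ → ℝ}
    (hF : ContDiff ℝ (⊤ : ℕ∞) F) : IsTestFunction Ω fun x ↦ F (x p) * φ x :=
  ⟨(hF.comp (by fun_prop)).mul hφ.contDiff, hφ.hasCompactSupport.mul_left,
    (tsupport_mul_subset_right (f := fun x : EuclideanSpace ℝ (Fin n) ↦ F (x p))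
      (g := φ)).trans hφ.tsupport_subset⟩

theorem gradient_coord_mul (hφ : IsTestFunction Ω φ) (p : Fin n) {F : ℝ → ℝ}
    (hF : Differentiable ℝ F) (x : EuclideanSpace ℝ (Fin n)) :
    gradient (fun x ↦ F (x p) * φ x) x =
      F (x p) • gradient φ x + (deriv F (x p) * φ x) • EuclideanSpace.single p 1 := by
  have hcoord : HasFDerivAt (fun x : EuclideanSpace ℝ (Fin n) ↦ F (x p))
      (deriv F (x p) • (EuclideanSpace.proj p : EuclideanSpace ℝ (Fin n) →L[ℝ] ℝ)) x :=
    (hF (x p)).hasDerivAt.comp_hasFDerivAt x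
      (EuclideanSpace.proj p : EuclideanSpace ℝ (Fin n) →L[ℝ] ℝ).hasFDerivAt
  refine ext_inner_right ℝ fun y ↦ ?_
  rw [inner_gradient_left, (hcoord.fun_mul (hφ.differentiable x).hasFDerivAt).fderiv,
    inner_add_left, real_inner_smul_left, real_inner_smul_left, inner_gradient_left,
    EuclideanSpace.inner_single_left]
  simp only [add_apply, smul_apply, smul_eq_mul, PiLp.proj_apply, Real.ringHom_apply, one_mul,
    add_right_inj]
  ring

theorem integral_mul_fderiv (hφ : IsTestFunction Ω φ) (hψ : IsTestFunction Ω ψ)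
    (e : EuclideanSpace ℝ (Fin n)) :
    ∫ x, φ x * fderiv ℝ ψ x e = -∫ x, fderiv ℝ φ x e * ψ x := by
  have hcont : ∀ {χ : EuclideanSpace ℝ (Fin n) → ℝ}, IsTestFunction Ω χ →
      Continuous fun x ↦ fderiv ℝ χ x e := fun hχ ↦
    (hχ.contDiff.continuous_fderiv (by simp)).clm_apply continuous_const
  refine integral_mul_fderiv_eq_neg_fderiv_mul_of_integrable ?_ ?_ ?_
    (fun x _ ↦ hφ.differentiable x) (fun x _ ↦ hψ.differentiable x)
  · exact ((hcont hφ).mul hψ.contDiff.continuous).integrable_of_hasCompactSupport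
      hψ.hasCompactSupport.mul_left
  · exact (hφ.contDiff.continuous.mul (hcont hψ)).integrable_of_hasCompactSupport
      hφ.hasCompactSupport.mul_right
  · exact (hφ.contDiff.continuous.mul hψ.contDiff.continuous).integrable_of_hasCompactSupport
      hψ.hasCompactSupport.mul_left

theorem inner_componentL (hφ : IsTestFunction Ω φ) {u : L2Scalar Ω} {g : L2Vector Ω}
    (hu : u =ᵐ[volume.restrict Ω] φ) (hg : g =ᵐ[volume.restrict Ω] gradient ψ) (p : Fin n) :
    inner ℝ u (componentL Ω p g) = ∫ x, φ x * fderiv ℝ ψ x (EuclideanSpace.single p 1) := by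
  rw [L2.inner_def]
  refine (integral_congr_ae ?_).trans (setIntegral_eq_integral_of_forall_compl_eq_zero
    fun x hx ↦ by rw [hφ.eq_zero_of_notMem hx, zero_mul])
  filter_upwards [hu, hg, coeFn_componentL p g] with x hux hgx hcomp
  rw [hux, hcomp, hgx, gradient_apply_coord, RCLike.inner_apply', conj_trivial]

end IsTestFunction

/-- `H¹₀(Ω)` is stable under multiplication by `F (x p)`, with
`∇(F(x_p) u) = F(x_p) ∇u + F'(x_p) u e_p`. -/
theorem coordMul_mem_sobolevGraph (hb : Bornology.IsBounded Ω) (p : Fin n) {F : ℝ → ℝ}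
    (hF : ContDiff ℝ (⊤ : ℕ∞) F) {q : L2Scalar Ω × L2Vector Ω} (hq : q ∈ sobolevGraph Ω) :
    (coordMul hb p hF q.1, coordMul hb p hF q.2 +
      axisL Ω p (coordMul hb p (contDiff_infty_iff_deriv.1 hF).2 q.1)) ∈ sobolevGraph Ω := by
  have hF' := (contDiff_infty_iff_deriv.1 hF).2
  refine map_mem_closure (t := (testGraph Ω : Set (L2Scalar Ω × L2Vector Ω)))
    (f := fun q ↦ (coordMul hb p hF q.1, coordMul hb p hF q.2 + axisL Ω p (coordMul hb p hF' q.1)))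
    (by fun_prop) hq ?_
  rintro ⟨u, g⟩ ⟨φ, hφ, hu, hg⟩
  refine ⟨_, hφ.coord_mul p hF, ?_, ?_⟩
  · filter_upwards [coeFn_coordMul hb p hF u, hu] with x hmul hux
    rw [hmul, hux, smul_eq_mul]
  · filter_upwards [coeFn_coordMul hb p hF g, coeFn_coordMul hb p hF' u, hu, hg,
      coeFn_axisL p (coordMul hb p hF' u), Lp.coeFn_add (coordMul hb p hF g)
        (axisL Ω p (coordMul hb p hF' u))] with x hmulg hmulu hux hgx haxis hadd
    rw [hadd, Pi.add_apply, haxis, hmulg, hmulu, hux, hgx,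
      hφ.gradient_coord_mul p (contDiff_infty_iff_deriv.1 hF).1, smul_eq_mul]

theorem inner_componentL_add_inner_componentL_eq_zero (p : Fin n) {q r : L2Scalar Ω × L2Vector Ω}
    (hq : q ∈ sobolevGraph Ω) (hr : r ∈ sobolevGraph Ω) :
    inner ℝ q.1 (componentL Ω p r.2) + inner ℝ (componentL Ω p q.2) r.1 = 0 := by
  have htest : ∀ q ∈ testGraph Ω, ∀ r ∈ testGraph Ω,
      inner ℝ q.1 (componentL Ω p r.2) + inner ℝ (componentL Ω p q.2) r.1 = 0 := by
    rintro q ⟨φ, hφ, hqφ, hqgrad⟩ r ⟨ψ, hψ, hrψ, hrgrad⟩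
    rw [hφ.inner_componentL hqφ hrgrad, real_inner_comm, hψ.inner_componentL hrψ hqgrad,
      hφ.integral_mul_fderiv hψ]
    simp_rw [mul_comm, neg_add_cancel]
  have hclosed : IsClosed {z : (L2Scalar Ω × L2Vector Ω) × (L2Scalar Ω × L2Vector Ω) |
      inner ℝ z.1.1 (componentL Ω p z.2.2) + inner ℝ (componentL Ω p z.1.2) z.2.1 = 0} :=
    isClosed_eq (by fun_prop) (by fun_prop)
  refine closure_minimal (fun z hz ↦ htest z.1 hz.1 z.2 hz.2) hclosed
    (s := (testGraph Ω : Set (L2Scalar Ω × L2Vector Ω)) ×ˢ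
      (testGraph Ω : Set (L2Scalar Ω × L2Vector Ω))) (a := (q, r)) ?_
  rw [closure_prod_eq]
  exact ⟨hq, hr⟩

end Sobolev

/-! ### Commutators with functions of a coordinate -/

section Commutator

variable {n : ℕ} {Ω : Set (EuclideanSpace ℝ (Fin n))} {u v : L2Scalar Ω} {g h : L2Vector Ω}
  {κ ν : ℝ}

/-- The weak form of `(-Δ - κ) (F(x_p) u) = -2 F'(x_p) ∂_p u - F''(x_p) u`. -/
theorem inner_commutator (hb : Bornology.IsBounded Ω) (p : Fin n) {F : ℝ → ℝ}
    (hF : ContDiff ℝ (⊤ : ℕ∞) F) (hu : IsFormEigenvector (sobolevGraph Ω) κ (u, g))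
    (hv : IsFormEigenvector (sobolevGraph Ω) ν (v, h)) :
    inner ℝ ((-2 : ℝ) • coordMul hb p (contDiff_infty_iff_deriv.1 hF).2 (componentL Ω p g) -
      coordMul hb p (contDiff_infty_iff_deriv.1 (contDiff_infty_iff_deriv.1 hF).2).2 u) v =
        (ν - κ) * inner ℝ (coordMul hb p hF u) v := by
  have hF' := (contDiff_infty_iff_deriv.1 hF).2
  have htest_u := hv.inner_eq _ (coordMul_mem_sobolevGraph hb p hF hu.mem)
  have htest_v := hu.inner_eq _ (coordMul_mem_sobolevGraph hb p hF hv.mem)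
  have hparts := inner_componentL_add_inner_componentL_eq_zero p
    (coordMul_mem_sobolevGraph hb p hF' hu.mem) hv.mem
  simp only [inner_add_right, inner_axisL] at htest_u htest_v
  rw [← inner_coordMul_left, ← inner_coordMul_left, ← inner_coordMul_left] at htest_v
  rw [map_add, componentL_axisL, componentL_coordMul, inner_add_left] at hparts
  rw [real_inner_comm (coordMul hb p hF g) h, real_inner_comm (coordMul hb p hF u) v,
    real_inner_comm (coordMul hb p hF' u) (componentL Ω p h)] at htest_u
  rw [inner_sub_left, real_inner_smul_left]
  linear_combination htest_u - htest_v - hparts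

theorem inner_commutator_coord (hb : Bornology.IsBounded Ω) (p : Fin n)
    (hu : IsFormEigenvector (sobolevGraph Ω) κ (u, g))
    (hv : IsFormEigenvector (sobolevGraph Ω) ν (v, h)) :
    inner ℝ ((-2 : ℝ) • componentL Ω p g) v =
      (ν - κ) * inner ℝ (coordMul hb p contDiff_id u) v := by
  rw [← inner_commutator hb p contDiff_id hu hv, coordMul, coordMul,
    mulLp_eq_smul (r := 1) _ (by simp), mulLp_eq_smul (r := 0) _ (by simp), one_smul, zero_smul,
    sub_zero]

theorem inner_commutator_of_deriv_eq (hb : Bornology.IsBounded Ω) (p : Fin n) {F K : ℝ → ℝ}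
    (hF : ContDiff ℝ (⊤ : ℕ∞) F) (hK : ContDiff ℝ (⊤ : ℕ∞) K) {r : ℝ}
    (hdF : ∀ t, deriv F t = r * K t) (hdK : ∀ t, deriv K t = -r * F t)
    (hu : IsFormEigenvector (sobolevGraph Ω) κ (u, g))
    (hv : IsFormEigenvector (sobolevGraph Ω) ν (v, h)) :
    inner ℝ (r ^ 2 • coordMul hb p hF u - (2 * r) • coordMul hb p hK (componentL Ω p g)) v =
      (ν - κ) * inner ℝ (coordMul hb p hF u) v := by
  have hd2F : ∀ t, deriv (deriv F) t = -r ^ 2 * F t := fun t ↦ by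
    rw [funext hdF, deriv_const_mul_field, hdK]
    ring
  rw [← inner_commutator hb p hF hu hv, coordMul_eq_smul_coordMul hb p _ hK hdF,
    coordMul_eq_smul_coordMul hb p _ hF hd2F]
  congr 1
  module

theorem inner_coordMul_componentL (hb : Bornology.IsBounded Ω) (p : Fin n)
    (hu : (u, g) ∈ sobolevGraph Ω) :
    inner ℝ (coordMul hb p contDiff_id u) ((-2 : ℝ) • componentL Ω p g) = ‖u‖ ^ 2 := by
  have hone : coordMul hb p (contDiff_infty_iff_deriv.1 contDiff_id).2 u = u := by
    rw [coordMul, mulLp_eq_smul (r := 1) _ (by simp), one_smul]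
  have hparts := inner_componentL_add_inner_componentL_eq_zero p
    (coordMul_mem_sobolevGraph hb p contDiff_id hu) hu
  rw [map_add, componentL_axisL, componentL_coordMul, inner_add_left, hone,
    inner_coordMul_left hb p contDiff_id (componentL Ω p g), real_inner_self_eq_norm_sq,
    real_inner_comm (coordMul hb p contDiff_id u)] at hparts
  rw [real_inner_smul_right]
  linarith

end Commutator

/-! ### Universal inequalities for Dirichlet eigenvalues -/

namespace FormEigenbasis

variable {n : ℕ} {Ω : Set (EuclideanSpace ℝ (Fin n))} (B : FormEigenbasis (sobolevGraph Ω))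

theorem eigenvalue_pos [NeZero n] (hb : Bornology.IsBounded Ω) (k : ℕ) : 0 < B.eigenvalue k := by
  rw [← B.norm_grad_sq k, sq_pos_iff, norm_ne_zero_iff]
  intro hzero
  have hone := inner_coordMul_componentL hb (0 : Fin n) (B.isFormEigenvector k).mem
  rw [hzero, map_zero (componentL Ω 0), smul_zero, inner_zero_right,
    B.basis.orthonormal.norm_eq_one] at hone
  norm_num at hone

theorem sum_sq_le_sum_mul_norm_componentL_sq (hb : Bornology.IsBounded Ω) (p : Fin n) (k : ℕ) :
    ∑ i ∈ Finset.range k, (B.eigenvalue k - B.eigenvalue i) ^ 2 ≤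
      4 * ∑ i ∈ Finset.range k,
        (B.eigenvalue k - B.eigenvalue i) * ‖componentL Ω p (B.grad i)‖ ^ 2 := by
  have hsum := sum_sq_mul_inner_le_sum_mul_norm_sq B.basis (l := B.eigenvalue)
    (s := Finset.range k) (μ := B.eigenvalue k)
    (fun i hi ↦ B.monotone (Finset.mem_range.1 hi).le)
    (fun j hj ↦ B.monotone (not_lt.1 (mt Finset.mem_range.2 hj)))
    (w := fun i ↦ coordMul hb p contDiff_id (B.basis i))
    (z := fun i ↦ (-2 : ℝ) • componentL Ω p (B.grad i))
    (fun i j ↦ by rw [inner_coordMul_left, real_inner_comm])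
    (fun i j ↦ inner_commutator_coord hb p (B.isFormEigenvector i) (B.isFormEigenvector j))
  have hone : ∀ i, inner ℝ (coordMul hb p contDiff_id (B.basis i))
      ((-2 : ℝ) • componentL Ω p (B.grad i)) = 1 := fun i ↦ by
    rw [inner_coordMul_componentL hb p (B.isFormEigenvector i).mem,
      B.basis.orthonormal.norm_eq_one, one_pow]
  simp only [hone, mul_one, norm_smul, mul_pow] at hsum
  refine hsum.trans_eq ?_
  rw [Finset.mul_sum]
  refine Finset.sum_congr rfl fun i _ ↦ ?_
  norm_num
  ring

theorem yangInequality [NeZero n] (hb : Bornology.IsBounded Ω) :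
    YangInequality (2 / n) B.eigenvalue := by
  intro k
  have hn : (0 : ℝ) < n := Nat.cast_pos.2 (NeZero.pos n)
  have hsum := Finset.sum_le_sum fun p (_ : p ∈ Finset.univ) ↦
    B.sum_sq_le_sum_mul_norm_componentL_sq hb p k
  simp only [Finset.sum_const, Finset.card_univ, Fintype.card_fin, nsmul_eq_mul] at hsum
  rw [← Finset.mul_sum, Finset.sum_comm] at hsum
  simp only [← Finset.mul_sum, sum_norm_componentL_sq, B.norm_grad_sq] at hsum
  refine le_of_mul_le_mul_left (hsum.trans_eq ?_) hn
  field_simp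
  ring

theorem add_mul_sq_le (hb : Bornology.IsBounded Ω) (p : Fin n) (α : ℝ) (i k : ℕ) :
    ((B.eigenvalue k - B.eigenvalue i) + (B.eigenvalue (k + 1) - B.eigenvalue i)) * α ^ 2 ≤
      4 * α ^ 2 * ‖componentL Ω p (B.grad i)‖ ^ 2 + (α ^ 2) ^ 2 +
        (B.eigenvalue k - B.eigenvalue i) * (B.eigenvalue (k + 1) - B.eigenvalue i) := by
  have hcos : ContDiff ℝ (⊤ : ℕ∞) fun t : ℝ ↦ Real.cos (α * t) := by fun_prop
  have hsin : ContDiff ℝ (⊤ : ℕ∞) fun t : ℝ ↦ Real.sin (α * t) := by fun_prop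
  have hlin (t : ℝ) : HasDerivAt (fun t ↦ α * t) α t := by
    simpa using (hasDerivAt_id t).const_mul α
  have hdcos (t : ℝ) : deriv (fun t ↦ Real.cos (α * t)) t = -α * Real.sin (α * t) := by
    rw [(hlin t).cos.deriv]
    ring
  have hdsin (t : ℝ) : deriv (fun t ↦ Real.sin (α * t)) t = α * Real.cos (α * t) := by
    rw [(hlin t).sin.deriv, mul_comm]
  have hgap : ∀ j, B.eigenvalue j ≤ B.eigenvalue k ∨ B.eigenvalue (k + 1) ≤ B.eigenvalue j :=
    fun j ↦ (le_or_gt j k).imp (fun hj ↦ B.monotone hj) fun hj ↦ B.monotone hj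
  have hpyth (f : L2Scalar Ω) :
      ‖coordMul hb p hcos f‖ ^ 2 + ‖coordMul hb p hsin f‖ ^ 2 = ‖f‖ ^ 2 :=
    norm_mulLp_sq_add_norm_mulLp_sq _ _ (fun _ ↦ Real.cos_sq_add_sin_sq _) f
  have hrot := add_mul_sq_le_of_rotation B.basis (c := B.eigenvalue i) (α := α)
    (B.monotone k.le_succ) hgap
    (u₁ := coordMul hb p hcos (B.basis i)) (u₂ := coordMul hb p hsin (B.basis i))
    (v₁ := coordMul hb p hcos (componentL Ω p (B.grad i)))
    (v₂ := coordMul hb p hsin (componentL Ω p (B.grad i)))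
    (by rw [hpyth, B.basis.orthonormal.norm_eq_one, one_pow])
    (by rw [inner_coordMul_left, inner_coordMul_left, coordMul, coordMul, mulLp_comm])
    (fun j ↦ by
      rw [← inner_commutator_of_deriv_eq hb p hcos hsin hdcos
          (fun t ↦ by rw [neg_neg, hdsin])
        (B.isFormEigenvector i) (B.isFormEigenvector j)]
      congr 1
      module)
    (fun j ↦ inner_commutator_of_deriv_eq hb p hsin hcos hdsin hdcos (B.isFormEigenvector i)
      (B.isFormEigenvector j))
  rwa [hpyth] at hrot

theorem sqrt_sub_sqrt_sq_le_eigenvalue [NeZero n] (hb : Bornology.IsBounded Ω) {i k : ℕ}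
    (hik : i ≤ k) :
    (√(B.eigenvalue (k + 1) - B.eigenvalue i) - √(B.eigenvalue k - B.eigenvalue i)) ^ 2 ≤
      4 * B.eigenvalue i / n := by
  have hn : (0 : ℝ) < n := Nat.cast_pos.2 (NeZero.pos n)
  refine sqrt_sub_sqrt_sq_le (sub_nonneg.2 (B.monotone hik))
    (sub_nonneg.2 (B.monotone (hik.trans k.le_succ))) fun t ht ↦ ?_
  have hsum := Finset.sum_le_sum fun p (_ : p ∈ Finset.univ) ↦ B.add_mul_sq_le hb p (√t) i k
  simp only [Real.sq_sqrt ht.le, Finset.sum_add_distrib, Finset.sum_const, Finset.card_univ,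
    Fintype.card_fin, nsmul_eq_mul, ← Finset.mul_sum, sum_norm_componentL_sq,
    B.norm_grad_sq] at hsum
  refine le_of_mul_le_mul_left (hsum.trans_eq ?_) hn
  field_simp

theorem eigenvalue_succ_sub_le [NeZero n] (hb : Bornology.IsBounded Ω) {i k : ℕ} (hik : i ≤ k) :
    B.eigenvalue (k + 1) - B.eigenvalue k ≤
      4 * √(B.eigenvalue i * B.eigenvalue (k + 1) / n) := by
  have hi := B.eigenvalue_pos hb i
  calc B.eigenvalue (k + 1) - B.eigenvalue k
      = (B.eigenvalue (k + 1) - B.eigenvalue i) - (B.eigenvalue k - B.eigenvalue i) := by ring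
    _ ≤ 2 * √(4 * B.eigenvalue i / n * (B.eigenvalue (k + 1) - B.eigenvalue i)) :=
      sub_le_two_mul_sqrt_of_sqrt_sub_sqrt_sq_le (sub_nonneg.2 (B.monotone hik))
        (sub_le_sub_right (B.monotone k.le_succ) _) (B.sqrt_sub_sqrt_sq_le_eigenvalue hb hik)
    _ ≤ 2 * √(4 * B.eigenvalue i / n * B.eigenvalue (k + 1)) := by gcongr; linarith
    _ = 2 * √(2 ^ 2 * (B.eigenvalue i * B.eigenvalue (k + 1) / n)) := by ring_nf
    _ = 4 * √(B.eigenvalue i * B.eigenvalue (k + 1) / n) := by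
      rw [Real.sqrt_mul (by positivity), Real.sqrt_sq zero_le_two]
      ring

end FormEigenbasis

/-! ### The optimal constant and the gaps -/

section Domain

variable {n : ℕ} [NeZero n] {Ω : Set (EuclideanSpace ℝ (Fin n))}

theorem dirichletEigenvalue_succ_pos (hΩ : IsOpen Ω) (hne : Ω.Nonempty)
    (hb : Bornology.IsBounded Ω) (k : ℕ) : 0 < dirichletEigenvalue Ω (k + 1) := by
  obtain ⟨B⟩ := nonempty_formEigenbasis_sobolevGraph hΩ hne hb
  rw [B.dirichletEigenvalue_succ]
  exact B.eigenvalue_pos hb k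

theorem dirichletEigenvalue_succ_le_mul_rpow (hΩ : IsOpen Ω) (hne : Ω.Nonempty)
    (hb : Bornology.IsBounded Ω) {k : ℕ} (hk : k ≠ 0) :
    dirichletEigenvalue Ω (k + 1) ≤
      (1 + 4 / n) * (k : ℝ) ^ ((2 : ℝ) / n) * dirichletEigenvalue Ω 1 := by
  obtain ⟨B⟩ := nonempty_formEigenbasis_sobolevGraph hΩ hne hb
  have hn : (0 : ℝ) < n := Nat.cast_pos.2 (NeZero.pos n)
  have hfirst : dirichletEigenvalue Ω 1 = B.eigenvalue 0 := B.dirichletEigenvalue_succ 0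
  rw [B.dirichletEigenvalue_succ, hfirst, show (4 : ℝ) / n = 2 * (2 / n) by ring]
  exact (B.yangInequality hb).le_mul_rpow (by positivity) (B.eigenvalue_pos hb 0).le hk

theorem dirichletEigenvalue_succ_sub_le_sqrt (hΩ : IsOpen Ω) (hne : Ω.Nonempty)
    (hb : Bornology.IsBounded Ω) {i k : ℕ} (hi : 1 ≤ i) (hik : i ≤ k) :
    dirichletEigenvalue Ω (k + 1) - dirichletEigenvalue Ω k ≤
      4 * √(dirichletEigenvalue Ω i * dirichletEigenvalue Ω (k + 1) / n) := by
  obtain ⟨B⟩ := nonempty_formEigenbasis_sobolevGraph hΩ hne hb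
  obtain ⟨j, rfl⟩ := Nat.exists_eq_add_of_le' hi
  obtain ⟨m, rfl⟩ := Nat.exists_eq_add_of_le' (hi.trans hik)
  simp only [B.dirichletEigenvalue_succ]
  exact B.eigenvalue_succ_sub_le hb (Nat.le_of_succ_le_succ hik)

end Domain

theorem isBoundedDomain_ball {n : ℕ} (c : EuclideanSpace ℝ (Fin n)) {r : ℝ} (hr : 0 < r) :
    IsBoundedDomain (Metric.ball c r) where
  isOpen := Metric.isOpen_ball
  isConnected := ⟨Metric.nonempty_ball.2 hr, (convex_ball c r).isPreconnected⟩
  isBounded := Metric.isBounded_ball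

theorem isChengYangConstant_one_add_four_div (n : ℕ) [NeZero n] :
    IsChengYangConstant n (1 + 4 / n) := fun _ hΩ _ hk ↦
  dirichletEigenvalue_succ_le_mul_rpow hΩ.isOpen hΩ.isConnected.nonempty hΩ.isBounded
    (Nat.one_le_iff_ne_zero.1 hk)

theorem isClosed_setOf_isChengYangConstant (n : ℕ) :
    IsClosed {C : ℝ | IsChengYangConstant n C} := by
  simp only [IsChengYangConstant, Set.ofPred_forall]
  exact isClosed_iInter fun Ω ↦ isClosed_iInter fun _ ↦ isClosed_iInter fun k ↦
    isClosed_iInter fun _ ↦ isClosed_le continuous_const (by fun_prop)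

theorem sqrt_mul_div_le_mul_sqrt_mul_rpow {a b C d x s : ℝ} (ha : 0 ≤ a) (hd : 0 ≤ d)
    (hx : 0 ≤ x) (h : b ≤ C * x ^ (2 * s) * a) : √(a * b / d) ≤ a * √(C / d) * x ^ s := by
  have hpow : x ^ (2 * s) = (x ^ s) ^ 2 := by
    rw [mul_comm, Real.rpow_mul hx, Real.rpow_two]
  rw [hpow] at h
  calc √(a * b / d) ≤ √(a * (C * (x ^ s) ^ 2 * a) / d) := by gcongr
    _ = √((a * x ^ s) ^ 2 * (C / d)) := by ring_nf
    _ = a * x ^ s * √(C / d) := by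
      rw [Real.sqrt_mul (sq_nonneg _), Real.sqrt_sq (by positivity)]
    _ = a * √(C / d) * x ^ s := by ring

namespace IsChengYangConstant

variable {n : ℕ} [NeZero n] {C : ℝ} {Ω : Set (EuclideanSpace ℝ (Fin n))}

theorem pos (hC : IsChengYangConstant n C) : 0 < C := by
  have hball := isBoundedDomain_ball (0 : EuclideanSpace ℝ (Fin n)) one_pos
  have hpos := dirichletEigenvalue_succ_pos hball.isOpen hball.isConnected.nonempty hball.isBounded
  have hle := hC _ hball 1 le_rfl
  rw [Nat.cast_one, Real.one_rpow, mul_one] at hle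
  exact pos_of_mul_pos_left ((hpos 1).trans_le hle) (hpos 0).le

theorem dirichletEigenvalue_succ_sub_le (hC : IsChengYangConstant n C) (hΩ : IsBoundedDomain Ω)
    {k : ℕ} (hk : 1 ≤ k) :
    dirichletEigenvalue Ω (k + 1) - dirichletEigenvalue Ω k ≤
      4 * dirichletEigenvalue Ω 1 * √(C / n) * (k : ℝ) ^ ((1 : ℝ) / n) := by
  have hne := hΩ.isConnected.nonempty
  have hpos := dirichletEigenvalue_succ_pos hΩ.isOpen hne hΩ.isBounded 0
  have hgrowth := hC Ω hΩ k hk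
  rw [show (2 : ℝ) / n = 2 * (1 / n) by ring] at hgrowth
  calc dirichletEigenvalue Ω (k + 1) - dirichletEigenvalue Ω k
      ≤ 4 * √(dirichletEigenvalue Ω 1 * dirichletEigenvalue Ω (k + 1) / n) :=
      dirichletEigenvalue_succ_sub_le_sqrt hΩ.isOpen hne hΩ.isBounded le_rfl hk
    _ ≤ 4 * (dirichletEigenvalue Ω 1 * √(C / n) * (k : ℝ) ^ ((1 : ℝ) / n)) := by
      gcongr
      exact sqrt_mul_div_le_mul_sqrt_mul_rpow hpos.le n.cast_nonneg k.cast_nonneg hgrowth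
    _ = 4 * dirichletEigenvalue Ω 1 * √(C / n) * (k : ℝ) ^ ((1 : ℝ) / n) := by ring

end IsChengYangConstant

theorem isLeast_chengYangConstant (n : ℕ) [NeZero n] :
    IsLeast {C : ℝ | IsChengYangConstant n C} (chengYangConstant n) :=
  (isClosed_setOf_isChengYangConstant n).isLeast_csInf
    ⟨_, isChengYangConstant_one_add_four_div n⟩ ⟨0, fun _ hC ↦ hC.pos.le⟩

theorem mainTheorem1 (n : ℕ) (hn : 1 ≤ n) :
    IsLeast {C : ℝ | IsChengYangConstant n C} (chengYangConstant n) ∧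
    chengYangConstant n ≤ 1 + 4 / (n : ℝ) ∧
    ∀ Ω : Set (EuclideanSpace ℝ (Fin n)), IsBoundedDomain Ω → ∀ k : ℕ, 1 ≤ k →
      dirichletEigenvalue Ω (k + 1) - dirichletEigenvalue Ω k ≤
        4 * dirichletEigenvalue Ω 1 * √(chengYangConstant n / n) * (k : ℝ) ^ ((1 : ℝ) / n) := by
  have : NeZero n := ⟨Nat.one_le_iff_ne_zero.1 hn⟩
  have hleast := isLeast_chengYangConstant n
  exact ⟨hleast, hleast.2 (isChengYangConstant_one_add_four_div n), fun _ hΩ _ hk ↦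
    hleast.1.dirichletEigenvalue_succ_sub_le hΩ hk⟩
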